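/- Fix $\alpha,\beta\in(0,1)$, and set $p=\lfloor\alpha/\beta\rfloor+1$, $\lambda=\dfrac{1-\alpha}{\alpha+\beta}$ and $L=[-1,-\beta]\cup\{\alpha\}$. A spherical $L$-code in $\mathbb{R}^d$ is a set of unit vectors in $\mathbb{R}^d$ such that the inner product of any two distinct vectors of the set lies in $L$; let $N_L(d)$ be the maximum cardinality of a spherical $L$-code in $\mathbb{R}^d$. Then \[ N_L(d)\le\begin{cases}2pd+O_L(1) & \text{if }\lambda\ge 1,\\ pd+o(d) & \text{if }\lambda<1,\end{cases} \] where $O_L(1)$ denotes a quantity bounded by a constant depending only on $L$ (that is, on $\alpha$ and $\beta$) and not on $d$, and $o(d)$ refers to $d\to\infty$ with $L$ fixed. -/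

import Mathlib

open Filter Asymptotics

/-- A spherical `L`-code in `ℝ^d`: a set of unit vectors whose pairwise inner products
(over pairs of distinct vectors) all lie in `L`. -/
def IsSphericalCode (L : Set ℝ) {d : ℕ} (C : Set (EuclideanSpace ℝ (Fin d))) : Prop :=
  (∀ x ∈ C, ‖x‖ = 1) ∧ C.Pairwise (fun x y => inner ℝ x y ∈ L)

/-- `N_L(d)`: the largest cardinality of a spherical `L`-code in `ℝ^d`, as an extended natural
number, so that a finite upper bound on it includes the finiteness of all such codes. -/
noncomputable def maxCodeSize (L : Set ℝ) (d : ℕ) : ℕ∞ :=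
  ⨆ (C : Set (EuclideanSpace ℝ (Fin d))) (_ : IsSphericalCode L C), C.encard

/-! The proof reduces codes to sparse families, in which every vector has boundedly many inner
products at most `-β`, and then bounds those.

Reduction (`exists_sparse_cover`). By Ramsey, a large code contains a simplex of any prescribed size
`T`, with all inner products `α`. Averaged over such a simplex, the inner products with a code
vector are close to `α` or at most about `-β` (`near_or_far`). In a maximal family of simplices
whose sums are pairwise far, nonnegativity of the norm and `α < p * β` leave at most `p` members.
Maximality bounds the number of vectors far from every member. The vectors near a given member form
a sparse family.

Sparse families. With `A` the deficiency matrix, `J` the all-ones matrix and `μ = 1 - α`, the Gram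
matrix is `α J + μ - A`. So `A ≤ μ` on vectors of sum zero, and the size of the family is at most `d
+ 1` plus the multiplicity of `μ` in `A`. If `λ < 1`, two negative pairs with all cross inner
products `α` cannot coexist, so deleting boundedly many vectors leaves an independent simplex. If `λ
≥ 1`, `finrank_eigenSubspace_le` bounds the multiplicity by half the number of vertices plus a
constant, which gives `2d + O(1)`.

The multiplicity bound has three cases. If `A ≤ μ` everywhere, a Perron-Frobenius argument shows
that eigenvectors are determined on a dominating set of density 1/2. If `A ≤ μ` fails on a ball of
bounded radius, eigenvectors are determined on a slightly larger ball. Otherwise eigenvectors live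
on one component; those vanishing on a net of density 1/3 are delocalised, and span a space of
dimension at most 1/6 of the component. -/

/-- Closed neighbourhood of `S` in the support graph of the matrix `A`. -/
noncomputable def closedNbhd {V : Type*} [Fintype V] (A : Matrix V V ℝ) (S : Finset V) :
    Finset V := by
  classical exact S ∪ Finset.univ.filter (fun j => ∃ i ∈ S, A i j ≠ 0)

/-! ### Balls, nets and dominating sets in the support graph. -/

section WeightedGraph

variable {V : Type*} [Fintype V] {A : Matrix V V ℝ}

open Matrix

lemma subset_closedNbhd (S : Finset V) : S ⊆ closedNbhd A S := by
  classical
  unfold closedNbhd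
  exact Finset.subset_union_left

lemma mem_closedNbhd {S : Finset V} {j : V} :
    j ∈ closedNbhd A S ↔ j ∈ S ∨ ∃ i ∈ S, A i j ≠ 0 := by
  classical
  simp [closedNbhd]

lemma card_closedNbhd_le {Δ : ℕ} (hΔ : ∀ i, {j | A i j ≠ 0}.ncard ≤ Δ) (S : Finset V) :
    (closedNbhd A S).card ≤ (Δ + 1) * S.card := by
  classical
  have hsub : closedNbhd A S ⊆
      S ∪ S.biUnion (fun i => Finset.univ.filter (fun j => A i j ≠ 0)) := by
    intro j hj
    rcases mem_closedNbhd.1 hj with h | ⟨i, hi, hij⟩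
    · exact Finset.mem_union_left _ h
    · exact Finset.mem_union_right _ (Finset.mem_biUnion.2 ⟨i, hi, by simpa using hij⟩)
  have h1 : (S.biUnion (fun i => Finset.univ.filter (fun j => A i j ≠ 0))).card ≤ S.card * Δ := by
    refine Finset.card_biUnion_le_card_mul _ _ _ fun i _ => ?_
    have := hΔ i
    rwa [Set.ncard_eq_toFinset_card', Set.toFinset_ofPred] at this
  calc _ ≤ _ := Finset.card_le_card hsub
    _ ≤ _ := Finset.card_union_le _ _
    _ ≤ (Δ + 1) * S.card := by nlinarith

/-- Ball of radius `k` around `v` in the support graph of `A`. -/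
noncomputable def supportBall (A : Matrix V V ℝ) (v : V) (k : ℕ) : Finset V :=
  (closedNbhd A)^[k] {v}

lemma supportBall_zero (v : V) : supportBall A v 0 = {v} := rfl

lemma supportBall_succ (v : V) (k : ℕ) :
    supportBall A v (k + 1) = closedNbhd A (supportBall A v k) :=
  Function.iterate_succ_apply' _ _ _

lemma supportBall_mono (v : V) : Monotone (supportBall A v) :=
  monotone_nat_of_le_succ fun k => by
    rw [supportBall_succ]; exact subset_closedNbhd _

lemma card_supportBall_le {Δ : ℕ} (hΔ : ∀ i, {j | A i j ≠ 0}.ncard ≤ Δ) (v : V) (k : ℕ) :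
    (supportBall A v k).card ≤ (Δ + 1) ^ k := by
  induction k with
  | zero => simp [supportBall_zero]
  | succ k ih =>
    rw [supportBall_succ, pow_succ']
    exact (card_closedNbhd_le hΔ _).trans (Nat.mul_le_mul_left _ ih)

/-- The vertices reachable from `v` in the support graph of `A`. -/
def reachSet (A : Matrix V V ℝ) (v : V) : Set V := {u | ∃ k, u ∈ supportBall A v k}

lemma mem_reachSet_of_adj {v i j : V} (hi : i ∈ reachSet A v) (hij : A i j ≠ 0) :
    j ∈ reachSet A v := by
  obtain ⟨k, hk⟩ := hi
  exact ⟨k + 1, by rw [supportBall_succ]; exact mem_closedNbhd.2 (Or.inr ⟨i, hk, hij⟩)⟩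

lemma self_mem_reachSet (v : V) : v ∈ reachSet A v := ⟨0, by simp [supportBall_zero]⟩

/-- A set hitting every walk of length two inside a connected component, of density one third. -/
lemma exists_two_step_net (v₀ : V) :
    ∃ D : Finset V, 3 * D.card ≤ (reachSet A v₀).ncard + 3 ∧
      ∀ u ∈ reachSet A v₀, u ∉ D →
        (∃ t ∈ D, A t u ≠ 0) ∨ ∃ t, ∃ v ∈ D, A t u ≠ 0 ∧ A v t ≠ 0 := by
  classical
  let H : Finset V := Finset.univ.filter (· ∈ reachSet A v₀)
  have hHmem : ∀ u, u ∈ H ↔ u ∈ reachSet A v₀ := by simp [H]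
  have hHc : (reachSet A v₀).ncard = H.card := by
    rw [Set.ncard_eq_toFinset_card']; congr 1; ext; simp [H]
  let lev : V → ℕ := fun u => if h : u ∈ reachSet A v₀ then Nat.find h else 0
  have hlev : ∀ u, u ∈ reachSet A v₀ → u ∈ supportBall A v₀ (lev u) := by
    intro u hu
    have : lev u = Nat.find hu := by simp [lev, hu]
    rw [this]; exact Nat.find_spec hu
  have hmin : ∀ u k, u ∈ supportBall A v₀ k → lev u ≤ k := by
    intro u k hk
    have hu : u ∈ reachSet A v₀ := ⟨k, hk⟩
    have : lev u = Nat.find hu := by simp [lev, hu]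
    rw [this]; exact Nat.find_min' hu hk
  have hpred : ∀ u ∈ reachSet A v₀, ∀ m, lev u = m + 1 →
      ∃ t ∈ reachSet A v₀, lev t = m ∧ A t u ≠ 0 := by
    intro u hu m hm
    have h1 := hlev u hu
    rw [hm, supportBall_succ, mem_closedNbhd] at h1
    rcases h1 with h1 | ⟨t, ht, htu⟩
    · have := hmin u m h1; omega
    · refine ⟨t, ⟨m, ht⟩, ?_, htu⟩
      have h2 := hmin t m ht
      have h3 : u ∈ supportBall A v₀ (lev t + 1) := by
        rw [supportBall_succ]
        exact mem_closedNbhd.2 (Or.inr ⟨t, hlev t ⟨m, ht⟩, htu⟩)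
      have := hmin u _ h3
      omega
  have hzero : ∀ u ∈ reachSet A v₀, lev u = 0 → u = v₀ := by
    intro u hu h
    have := hlev u hu
    rw [h, supportBall_zero] at this
    simpa using this
  -- The net is the sparsest class of distances from `v₀` modulo 3, together with `v₀`. Going back
  -- two steps towards `v₀` visits three consecutive levels, or else reaches `v₀`.
  obtain ⟨r, hr, hrc⟩ : ∃ r ∈ Finset.range 3,
      3 * (H.filter (fun u => lev u % 3 = r)).card ≤ H.card := by
    by_contra! hcon
    have hs : H.card = ∑ r ∈ Finset.range 3, (H.filter (fun u => lev u % 3 = r)).card :=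
      Finset.card_eq_sum_card_fiberwise fun u _ => by
        simpa using Nat.mod_lt _ (by norm_num)
    rw [Finset.sum_range_succ, Finset.sum_range_succ, Finset.sum_range_one] at hs
    have h0 := hcon 0 (by simp)
    have h1 := hcon 1 (by simp)
    have h2 := hcon 2 (by simp)
    omega
  refine ⟨insert v₀ (H.filter (fun u => lev u % 3 = r)), ?_, ?_⟩
  · have := Finset.card_insert_le v₀ (H.filter (fun u => lev u % 3 = r))
    omega
  · intro u hu huD
    have hr3 : r < 3 := by simpa using hr
    simp only [Finset.mem_insert, Finset.mem_filter, hHmem, not_or, not_and] at huD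
    have hu0 : lev u ≠ 0 := fun h => huD.1 (hzero u hu h)
    obtain ⟨m, hm⟩ := Nat.exists_eq_succ_of_ne_zero hu0
    obtain ⟨t, ht, htl, htu⟩ := hpred u hu m hm
    by_cases htD : t = v₀ ∨ lev t % 3 = r
    · left
      refine ⟨t, ?_, htu⟩
      simp only [Finset.mem_insert, Finset.mem_filter, hHmem]
      tauto
    · right
      push Not at htD
      have ht0 : lev t ≠ 0 := fun h => htD.1 (hzero t ht h)
      obtain ⟨m', hm'⟩ := Nat.exists_eq_succ_of_ne_zero ht0
      obtain ⟨s, hs, hsl, hst⟩ := hpred t ht m' hm'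
      refine ⟨t, s, ?_, htu, hst⟩
      simp only [Finset.mem_insert, Finset.mem_filter, hHmem]
      right
      refine ⟨hs, ?_⟩
      have := huD.2 hu
      have := htD.2
      omega

/-- Every vertex outside `D` with a neighbour has a neighbour in `D`, and `D` is at most half. -/
lemma exists_dominating_half (hsymm : A.IsSymm) (hdiag : ∀ i, A i i = 0) :
    ∃ D : Finset V, 2 * D.card ≤ Fintype.card V ∧
      ∀ u ∉ D, (∃ v, A u v ≠ 0) → ∃ v ∈ D, A v u ≠ 0 := by
  classical
  let S : Finset V := Finset.univ.filter (fun v => ∃ u, A v u ≠ 0)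
  let P : Finset V → Prop := fun I => I ⊆ S ∧ ∀ i ∈ I, ∀ j ∈ I, A i j = 0
  -- A maximum independent set `I` of non-isolated vertices and its complement in `S` dominate each
  -- other; the smaller one serves.
  obtain ⟨I, hI, hmax⟩ : ∃ I, P I ∧ ∀ J, P J → J.card ≤ I.card := by
    obtain ⟨I, hI, hm⟩ := Finset.exists_max_image (Finset.univ.filter P) Finset.card
      ⟨∅, by simp [P]⟩
    exact ⟨I, by simpa using hI, fun J hJ => hm J (by simpa using hJ)⟩
  have hout : ∀ u ∈ S, u ∉ I → ∃ v ∈ I, A v u ≠ 0 := by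
    intro u hu huI
    by_contra! hcon
    have : P (insert u I) := by
      refine ⟨Finset.insert_subset hu hI.1, ?_⟩
      intro i hi j hj
      rcases Finset.mem_insert.1 hi with h1 | h1 <;> rcases Finset.mem_insert.1 hj with h2 | h2
      · rw [h1, h2]; exact hdiag _
      · rw [h1, ← hsymm.apply]; exact hcon _ h2
      · rw [h2]; exact hcon _ h1
      · exact hI.2 _ h1 _ h2
    have := hmax _ this
    rw [Finset.card_insert_of_notMem huI] at this
    omega
  have hin : ∀ u ∈ I, ∃ v ∈ S \ I, A v u ≠ 0 := by
    intro u hu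
    obtain ⟨v, hv⟩ : ∃ v, A u v ≠ 0 := by simpa [S] using hI.1 hu
    have hvu : A v u ≠ 0 := by rwa [hsymm.apply]
    refine ⟨v, Finset.mem_sdiff.2 ⟨?_, fun h => hv (hI.2 _ hu _ h)⟩, hvu⟩
    simpa [S] using ⟨u, hvu⟩
  have hcard : (S \ I).card + I.card = S.card := Finset.card_sdiff_add_card_eq_card hI.1
  have hS : S.card ≤ Fintype.card V := Finset.card_le_univ _
  by_cases h : 2 * I.card ≤ Fintype.card V
  · exact ⟨I, h, fun u hu hv => hout u (by simpa [S] using hv) hu⟩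
  · refine ⟨S \ I, by omega, fun u hu hv => hin u ?_⟩
    by_contra huI
    exact hu (Finset.mem_sdiff.2 ⟨by simpa [S] using hv, huI⟩)

end WeightedGraph

/-! ### Localisation and delocalisation of eigenvectors. -/

section QuadraticForm

variable {V : Type*} [Fintype V] {A : Matrix V V ℝ}

open Matrix

lemma dotProduct_mulVec_eq_sum (A : Matrix V V ℝ) (x y : V → ℝ) :
    x ⬝ᵥ (A *ᵥ y) = ∑ i, ∑ j, x i * A i j * y j := by
  simp [dotProduct, mulVec, Finset.mul_sum, mul_assoc]

lemma dotProduct_mulVec_symm (hsymm : A.IsSymm) (x y : V → ℝ) :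
    x ⬝ᵥ (A *ᵥ y) = y ⬝ᵥ (A *ᵥ x) := by
  rw [dotProduct_mulVec, ← mulVec_transpose, hsymm.eq, dotProduct_comm]

lemma abs_dotProduct_abs (c : V → ℝ) : |c| ⬝ᵥ |c| = c ⬝ᵥ c := by
  simp [dotProduct, ← abs_mul_abs_self]

lemma dotProduct_mulVec_le_abs (hA : ∀ i j, 0 ≤ A i j) (c : V → ℝ) :
    c ⬝ᵥ (A *ᵥ c) ≤ |c| ⬝ᵥ (A *ᵥ |c|) := by
  rw [dotProduct_mulVec_eq_sum, dotProduct_mulVec_eq_sum]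
  refine Finset.sum_le_sum fun i _ => Finset.sum_le_sum fun j _ => ?_
  calc c i * A i j * c j ≤ |c i * A i j * c j| := le_abs_self _
    _ = |c| i * A i j * |c| j := by
      rw [abs_mul, abs_mul, abs_of_nonneg (hA i j)]; rfl

/-- Two disjointly supported, mutually orthogonal nonnegative vectors cannot witness two
directions on which `μ - A` fails to be positive, if it is positive on vectors of sum zero. -/
lemma eq_zero_of_neg_direction {μ : ℝ} (hsymm : A.IsSymm)
    (hP : ∀ c : V → ℝ, ∑ i, c i = 0 → c ⬝ᵥ (A *ᵥ c) ≤ μ * (c ⬝ᵥ c))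
    {f g : V → ℝ} (hg : 0 ≤ g) (hfQ : μ * (f ⬝ᵥ f) < f ⬝ᵥ (A *ᵥ f))
    (hgQ : μ * (g ⬝ᵥ g) ≤ g ⬝ᵥ (A *ᵥ g)) (hfg : f ⬝ᵥ g = 0) (hfAg : f ⬝ᵥ (A *ᵥ g) = 0) :
    g = 0 := by
  by_contra hg0
  have ha : 0 < ∑ i, g i := by
    refine lt_of_le_of_ne (Finset.sum_nonneg fun i _ => hg i) fun h => hg0 ?_
    funext i
    exact (Finset.sum_eq_zero_iff_of_nonneg fun i _ => hg i).1 h.symm i (Finset.mem_univ i)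
  set a := ∑ i, g i
  set b := ∑ i, f i
  -- On this combination the cross terms vanish: the `g` part cannot offset the strict excess of the
  -- `f` part, whose weight is `a ^ 2 > 0`.
  have hsum : ∑ i, (a • f - b • g) i = 0 := by
    simp only [Pi.sub_apply, Pi.smul_apply, smul_eq_mul, Finset.sum_sub_distrib,
      ← Finset.mul_sum]
    change a * b - b * a = 0
    ring
  have h := hP _ hsum
  have hgAf : g ⬝ᵥ (A *ᵥ f) = 0 := by rw [dotProduct_mulVec_symm hsymm, hfAg]
  have hgf : g ⬝ᵥ f = 0 := by rw [dotProduct_comm, hfg]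
  simp only [mulVec_sub, mulVec_smul, sub_dotProduct, dotProduct_sub, smul_dotProduct,
    dotProduct_smul, smul_eq_mul, hfAg, hgAf, hfg, hgf, mul_zero, sub_zero, zero_sub] at h
  nlinarith [mul_pos ha ha, mul_nonneg (mul_self_nonneg b) (sub_nonneg.2 hgQ),
    mul_pos (mul_pos ha ha) (sub_pos.2 hfQ)]

lemma eigenvector_dotProduct {μ : ℝ} {c : V → ℝ} (hc : A *ᵥ c = μ • c) :
    μ * (c ⬝ᵥ c) = c ⬝ᵥ (A *ᵥ c) := by
  rw [hc, dotProduct_smul, smul_eq_mul]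

lemma le_abs_of_eigenvector {μ : ℝ} (hA : ∀ i j, 0 ≤ A i j) {c : V → ℝ}
    (hc : A *ᵥ c = μ • c) : μ * (|c| ⬝ᵥ |c|) ≤ |c| ⬝ᵥ (A *ᵥ |c|) := by
  rw [abs_dotProduct_abs, eigenvector_dotProduct hc]
  exact dotProduct_mulVec_le_abs hA c

lemma dotProduct_mulVec_eq_zero_of_separated {f g : V → ℝ}
    (h : ∀ i j, f i ≠ 0 → A i j ≠ 0 → g j = 0) : f ⬝ᵥ (A *ᵥ g) = 0 := by
  rw [dotProduct_mulVec_eq_sum]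
  refine Finset.sum_eq_zero fun i _ => Finset.sum_eq_zero fun j _ => ?_
  by_cases hf : f i = 0
  · simp [hf]
  by_cases hij : A i j = 0
  · simp [hij]
  · simp [h i j hf hij]

/-- As `A` is nonnegative, `|c|` does at least as well as `c` in the quadratic form, so it can play
the second direction in `eq_zero_of_neg_direction`. -/
lemma abs_separated_eigenvector_eq_zero {μ : ℝ} (hsymm : A.IsSymm) (hA : ∀ i j, 0 ≤ A i j)
    (hP : ∀ c : V → ℝ, ∑ i, c i = 0 → c ⬝ᵥ (A *ᵥ c) ≤ μ * (c ⬝ᵥ c))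
    {f c : V → ℝ} (hfQ : μ * (f ⬝ᵥ f) < f ⬝ᵥ (A *ᵥ f))
    (hc : A *ᵥ c = μ • c) (hdis : ∀ i, f i ≠ 0 → c i = 0)
    (hsep : ∀ i j, f i ≠ 0 → A i j ≠ 0 → c j = 0) : c = 0 := by
  have : |c| = 0 := by
    refine eq_zero_of_neg_direction hsymm hP (abs_nonneg c) hfQ (le_abs_of_eigenvector hA hc)
      ?_ (dotProduct_mulVec_eq_zero_of_separated fun i j hi hij => ?_)
    · refine Finset.sum_eq_zero fun i _ => ?_
      by_cases h : f i = 0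
      · simp [h]
      · simp [hdis i h]
    · simp [hsep i j hi hij]
  simpa using this

/-- Localisation of a quadratic-form bound to a norm bound. -/
lemma mulVec_dotProduct_mulVec_le {μ : ℝ} (hμ : 0 < μ) (hsymm : A.IsSymm)
    (hA : ∀ i j, 0 ≤ A i j) {S S' : Finset V} (hS : closedNbhd A S' ⊆ S)
    (hP : ∀ z : V → ℝ, (∀ i ∉ S, z i = 0) → z ⬝ᵥ (A *ᵥ z) ≤ μ * (z ⬝ᵥ z))
    {y : V → ℝ} (hy : ∀ i ∉ S', y i = 0) :
    (A *ᵥ y) ⬝ᵥ (A *ᵥ y) ≤ μ ^ 2 * (y ⬝ᵥ y) := by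
  have hAy : ∀ i ∉ S, (A *ᵥ y) i = 0 := by
    intro i hi
    refine Finset.sum_eq_zero fun j _ => ?_
    by_cases hj : j ∈ S'
    · have : A i j = 0 := by
        by_contra h
        exact hi (hS (mem_closedNbhd.2 (Or.inr ⟨j, hj, by rwa [hsymm.apply]⟩)))
      simp [this]
    · simp [hy j hj]
  have hy' : ∀ i ∉ S, y i = 0 := fun i hi => hy i fun h => hi (hS (subset_closedNbhd _ h))
  set z := A *ᵥ y with hz
  -- The upper bound at `μ y + z` is added to the lower bound at `μ y - z`, which follows from the
  -- upper bound at its absolute value. The terms in `y ⬝ᵥ A y` and `z ⬝ᵥ A z` cancel, and the claim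
  -- remains.
  have h1 := hP (μ • y + z) (fun i hi => by simp [hy' i hi, hAy i hi])
  have h2 := hP (|μ • y - z|) (fun i hi => by simp [hy' i hi, hAy i hi])
  rw [abs_dotProduct_abs] at h2
  have h3 : -((μ • y - z) ⬝ᵥ (A *ᵥ (μ • y - z))) ≤ |μ • y - z| ⬝ᵥ (A *ᵥ |μ • y - z|) := by
    rw [dotProduct_mulVec_eq_sum, dotProduct_mulVec_eq_sum, ← Finset.sum_neg_distrib]
    refine Finset.sum_le_sum fun i _ => ?_
    rw [← Finset.sum_neg_distrib]
    refine Finset.sum_le_sum fun j _ => ?_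
    refine (neg_le_abs _).trans (le_of_eq ?_)
    rw [abs_mul, abs_mul, abs_of_nonneg (hA i j)]; rfl
  have hyz : z ⬝ᵥ y = y ⬝ᵥ z := dotProduct_comm _ _
  have hyAz : y ⬝ᵥ (A *ᵥ z) = z ⬝ᵥ z := by rw [dotProduct_mulVec_symm hsymm]
  simp only [mulVec_sub, mulVec_add, mulVec_smul, sub_dotProduct, dotProduct_sub, add_dotProduct,
    dotProduct_add, smul_dotProduct, dotProduct_smul, smul_eq_mul, hyAz, ← hz, hyz] at h1 h2 h3
  nlinarith

/-- The part of `A²` made of the walks of length two that meet the complement of `U`. -/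
noncomputable def exitMatrix (A : Matrix V V ℝ) (U : Set V) : Matrix V V ℝ := by
  classical exact fun v u => ∑ t, A v t * A t u * (if v ∈ U ∧ t ∈ U then 0 else 1)

/-- Two steps of `A`, restricted to `U` after each step. -/
noncomputable def restrictedTwoStep (A : Matrix V V ℝ) (U : Set V) (x : V → ℝ) : V → ℝ :=
  U.indicator (A *ᵥ U.indicator (A *ᵥ x))

lemma two_step_eq_add (U : Set V) (x : V → ℝ) :
    A *ᵥ (A *ᵥ x) = restrictedTwoStep A U x + exitMatrix A U *ᵥ x := by
  classical
  funext v
  have h1 : (exitMatrix A U *ᵥ x) v =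
      ∑ t, A v t * (if v ∈ U ∧ t ∈ U then 0 else 1) * (A *ᵥ x) t := by
    simp only [exitMatrix, mulVec, dotProduct, Finset.sum_mul, Finset.mul_sum]
    rw [Finset.sum_comm]
    refine Finset.sum_congr rfl fun t _ => Finset.sum_congr rfl fun u _ => ?_
    ring
  rw [Pi.add_apply, h1]
  by_cases hv : v ∈ U
  · rw [restrictedTwoStep, Set.indicator_of_mem hv]
    simp only [mulVec, dotProduct, ← Finset.sum_add_distrib]
    refine Finset.sum_congr rfl fun t _ => ?_
    by_cases ht : t ∈ U
    · simp only [hv, ht, Set.indicator_of_mem, and_self, if_true, mul_zero, zero_mul, add_zero]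
      rfl
    · simp [hv, ht]
  · rw [restrictedTwoStep, Set.indicator_of_notMem hv]
    simp [hv, mulVec, dotProduct]

lemma mulVec_nonneg_of_nonneg (hA : ∀ i j, 0 ≤ A i j) {x : V → ℝ} (hx : 0 ≤ x) : 0 ≤ A *ᵥ x :=
  fun i => Finset.sum_nonneg fun j _ => mul_nonneg (hA i j) (hx j)

lemma restrictedTwoStep_nonneg (hA : ∀ i j, 0 ≤ A i j) (U : Set V) {x : V → ℝ} (hx : 0 ≤ x) :
    0 ≤ restrictedTwoStep A U x :=
  Set.indicator_nonneg fun i _ => mulVec_nonneg_of_nonneg hA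
    (Set.indicator_nonneg fun i _ => mulVec_nonneg_of_nonneg hA hx i) i

lemma exitMatrix_nonneg (hA : ∀ i j, 0 ≤ A i j) (U : Set V) (i j : V) :
    0 ≤ exitMatrix A U i j :=
  Finset.sum_nonneg fun t _ => mul_nonneg (mul_nonneg (hA _ _) (hA _ _)) (by split_ifs <;> simp)

/-- All terms are nonnegative, so the square of a row sum dominates the sum of squares; each column
in the support of `x` has an entry at least `w ^ 2`. -/
lemma exitMatrix_dotProduct_ge {w : ℝ} (hw : 0 < w) (hA : ∀ i j, 0 ≤ A i j) {U : Set V}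
    {x : V → ℝ} (hx : 0 ≤ x)
    (hex : ∀ u, x u ≠ 0 → ∃ t v, w ≤ A v t ∧ w ≤ A t u ∧ (v ∉ U ∨ t ∉ U)) :
    w ^ 4 * (x ⬝ᵥ x) ≤ (exitMatrix A U *ᵥ x) ⬝ᵥ (exitMatrix A U *ᵥ x) := by
  classical
  set N := exitMatrix A U with hN
  have hN0 : ∀ i j, 0 ≤ N i j := exitMatrix_nonneg hA U
  have h1 : ∀ v, ∑ u, (N v u * x u) ^ 2 ≤ (N *ᵥ x) v * (N *ᵥ x) v := by
    intro v
    rw [← pow_two]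
    exact Finset.sum_sq_le_sq_sum_of_nonneg fun u _ => mul_nonneg (hN0 v u) (hx u)
  calc w ^ 4 * (x ⬝ᵥ x) = ∑ u, w ^ 4 * (x u * x u) := by rw [dotProduct, Finset.mul_sum]
    _ ≤ ∑ u, ∑ v, (N v u * x u) ^ 2 := by
      refine Finset.sum_le_sum fun u _ => ?_
      by_cases hu : x u = 0
      · simp [hu]
      obtain ⟨t, v, hvt, htu, hout⟩ := hex u hu
      have hNv : w ^ 2 ≤ N v u := by
        calc w ^ 2 ≤ A v t * A t u := by nlinarith
          _ = A v t * A t u * (if v ∈ U ∧ t ∈ U then 0 else 1) := by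
            rw [if_neg (by tauto), mul_one]
          _ ≤ N v u := Finset.single_le_sum
            (f := fun t => A v t * A t u * (if v ∈ U ∧ t ∈ U then (0 : ℝ) else 1))
            (fun t _ => mul_nonneg (mul_nonneg (hA _ _) (hA _ _)) (by split_ifs <;> simp))
            (Finset.mem_univ t)
      calc w ^ 4 * (x u * x u) = (w ^ 2) ^ 2 * (x u) ^ 2 := by ring
        _ ≤ (N v u) ^ 2 * (x u) ^ 2 := by gcongr
        _ = (N v u * x u) ^ 2 := by ring
        _ ≤ ∑ v, (N v u * x u) ^ 2 := Finset.single_le_sum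
          (f := fun v => (N v u * x u) ^ 2) (fun v _ => sq_nonneg _) (Finset.mem_univ v)
    _ = ∑ v, ∑ u, (N v u * x u) ^ 2 := Finset.sum_comm
    _ ≤ _ := Finset.sum_le_sum fun v _ => h1 v

/-- Restricting the walks to `U` shrinks the norm, when walks of length two can leave `U`. -/
lemma restrictedTwoStep_dotProduct_le {μ w : ℝ} (hμ : 0 < μ) (hw : 0 < w) (hsymm : A.IsSymm)
    (hA : ∀ i j, 0 ≤ A i j) {U : Set V} {S₂ S₁ S₀ : Finset V}
    (h21 : closedNbhd A S₁ ⊆ S₂) (h10 : closedNbhd A S₀ ⊆ S₁)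
    (hP : ∀ z : V → ℝ, (∀ i ∉ S₂, z i = 0) → z ⬝ᵥ (A *ᵥ z) ≤ μ * (z ⬝ᵥ z))
    {x : V → ℝ} (hx : 0 ≤ x) (hxS : ∀ i ∉ S₀, x i = 0)
    (hex : ∀ u, x u ≠ 0 → ∃ t v, w ≤ A v t ∧ w ≤ A t u ∧ (v ∉ U ∨ t ∉ U)) :
    restrictedTwoStep A U x ⬝ᵥ restrictedTwoStep A U x ≤ (μ ^ 4 - w ^ 4) * (x ⬝ᵥ x) ∧
      ∀ i ∉ S₂, restrictedTwoStep A U x i = 0 := by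
  have hsupp : ∀ {S S' : Finset V} {y : V → ℝ}, closedNbhd A S ⊆ S' → (∀ i ∉ S, y i = 0) →
      ∀ i ∉ S', (A *ᵥ y) i = 0 := by
    intro S S' y hSS hy i hi
    refine Finset.sum_eq_zero fun j _ => ?_
    by_cases hj : j ∈ S
    · have : A i j = 0 := by
        by_contra h
        exact hi (hSS (mem_closedNbhd.2 (Or.inr ⟨j, hj, by rwa [hsymm.apply]⟩)))
      simp [this]
    · simp [hy j hj]
  have hAx := hsupp h10 hxS
  constructor
  · have e1 := mulVec_dotProduct_mulVec_le hμ hsymm hA h21 hP hAx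
    have e2 := mulVec_dotProduct_mulVec_le hμ hsymm hA
      (h10.trans ((subset_closedNbhd _).trans h21)) hP hxS
    have e3 := exitMatrix_dotProduct_ge hw hA hx hex
    rw [two_step_eq_add U x] at e1
    -- The cross term is nonnegative, so the squared norm of the exit part is lost from the bound `μ
    -- ^ 4 * (x ⬝ᵥ x)` on two full steps.
    have e4 : 0 ≤ restrictedTwoStep A U x ⬝ᵥ (exitMatrix A U *ᵥ x) :=
      dotProduct_nonneg_of_nonneg (restrictedTwoStep_nonneg hA U hx)
        (mulVec_nonneg_of_nonneg (exitMatrix_nonneg hA U) hx)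
    have e5 := dotProduct_comm (exitMatrix A U *ᵥ x) (restrictedTwoStep A U x)
    simp only [add_dotProduct, dotProduct_add] at e1
    nlinarith [mul_le_mul_of_nonneg_left e2 (sq_nonneg μ)]
  · refine fun i hi => Set.indicator_apply_eq_zero.2 fun _ => hsupp h21 (y := _) ?_ i hi
    exact fun j hj => Set.indicator_apply_eq_zero.2 fun _ => hAx j hj

lemma restrictedTwoStep_dotProduct_eigenvector {μ : ℝ} (hsymm : A.IsSymm) {U : Set V}
    {c : V → ℝ} (hc : A *ᵥ c = μ • c) (hcU : ∀ i ∉ U, c i = 0) (x : V → ℝ) :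
    restrictedTwoStep A U x ⬝ᵥ c = μ ^ 2 * (x ⬝ᵥ c) := by
  have hind : ∀ y : V → ℝ, U.indicator y ⬝ᵥ c = y ⬝ᵥ c := fun y => by
    refine Finset.sum_congr rfl fun i _ => ?_
    by_cases hi : i ∈ U
    · simp [hi]
    · simp [hcU i hi]
  have hstep : ∀ y : V → ℝ, (A *ᵥ y) ⬝ᵥ c = μ * (y ⬝ᵥ c) := fun y => by
    rw [dotProduct_comm, dotProduct_mulVec_symm hsymm, hc, dotProduct_smul, smul_eq_mul]
  rw [restrictedTwoStep, hind, hstep, hind, hstep]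
  ring

/-- Delocalisation: an eigenvector supported on `U` has small entries. -/
lemma eigenvector_entry_sq_le {μ w : ℝ} (hμ : 0 < μ) (hw : 0 < w) (hsymm : A.IsSymm)
    (hwμ : w ≤ μ) (hA : ∀ i j, 0 ≤ A i j) {U : Set V}
    (hex : ∀ u ∈ U, ∃ t v, w ≤ A v t ∧ w ≤ A t u ∧ (v ∉ U ∨ t ∉ U)) (k : ℕ) {v : V} (hv : v ∈ U)
    (hP : ∀ z : V → ℝ, (∀ i ∉ supportBall A v (2 * k), z i = 0) →
      z ⬝ᵥ (A *ᵥ z) ≤ μ * (z ⬝ᵥ z))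
    {c : V → ℝ} (hc : A *ᵥ c = μ • c) (hcU : ∀ i ∉ U, c i = 0) :
    c v ^ 2 ≤ (1 - w ^ 4 / μ ^ 4) ^ k * (c ⬝ᵥ c) := by
  classical
  have hw4 : w ^ 4 ≤ μ ^ 4 := by gcongr
  -- `x` is the restricted walk started at `v`, after `2 * m` steps. Its pairing with `c` grows by
  -- exactly `μ ^ 2` per round while its squared norm grows by less than `μ ^ 4`; Cauchy-Schwarz
  -- then bounds `c v`.
  have key : ∀ m ≤ k, ∃ x : V → ℝ, 0 ≤ x ∧ (∀ i ∉ supportBall A v (2 * m), x i = 0) ∧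
      (∀ i, x i ≠ 0 → i ∈ U) ∧ x ⬝ᵥ x ≤ (μ ^ 4 - w ^ 4) ^ m ∧ x ⬝ᵥ c = μ ^ (2 * m) * c v := by
    intro m
    induction m with
    | zero =>
      intro _
      refine ⟨Pi.single v 1, by simp, ?_, ?_, by simp, by simp⟩
      · intro i hi
        simp only [mul_zero, supportBall_zero, Finset.mem_singleton] at hi
        simp [hi]
      · intro i hi
        by_cases h : i = v
        · rwa [h]
        · simp [h] at hi
    | succ m ih =>
      intro hm
      obtain ⟨x, hx0, hxS, hxU, hxx, hxc⟩ := ih (by omega)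
      have hb : ∀ j, closedNbhd A (supportBall A v j) ⊆ supportBall A v (j + 1) := fun j => by
        rw [supportBall_succ]
      obtain ⟨h1, h2⟩ := restrictedTwoStep_dotProduct_le hμ hw hsymm hA (U := U)
        (hb (2 * m + 1)) (hb (2 * m))
        (fun z hz => hP z fun i hi => hz i fun h => hi (supportBall_mono v (by omega) h))
        hx0 hxS (fun u hu => hex u (hxU u hu))
      refine ⟨restrictedTwoStep A U x, restrictedTwoStep_nonneg hA U hx0, h2, ?_, ?_, ?_⟩
      · intro i hi
        by_contra h
        exact hi (Set.indicator_of_notMem h _)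
      · refine h1.trans ?_
        rw [pow_succ' (μ ^ 4 - w ^ 4) m]
        exact mul_le_mul_of_nonneg_left hxx (sub_nonneg.2 hw4)
      · rw [restrictedTwoStep_dotProduct_eigenvector hsymm hc hcU, hxc]
        ring
  obtain ⟨x, -, -, -, hxx, hxc⟩ := key k le_rfl
  have hcs : (x ⬝ᵥ c) ^ 2 ≤ (x ⬝ᵥ x) * (c ⬝ᵥ c) := by
    have := Finset.sum_mul_sq_le_sq_mul_sq Finset.univ x c
    simpa only [dotProduct, pow_two] using this
  have hcc : 0 ≤ c ⬝ᵥ c := Finset.sum_nonneg fun i _ => mul_self_nonneg _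
  have h1 : (μ ^ 4) ^ k * c v ^ 2 ≤ (μ ^ 4 - w ^ 4) ^ k * (c ⬝ᵥ c) := by
    calc (μ ^ 4) ^ k * c v ^ 2 = (x ⬝ᵥ c) ^ 2 := by rw [hxc]; ring
      _ ≤ _ := hcs
      _ ≤ _ := mul_le_mul_of_nonneg_right hxx hcc
  have h2 : 1 - w ^ 4 / μ ^ 4 = (μ ^ 4 - w ^ 4) / μ ^ 4 := by field_simp
  rw [h2, div_pow, div_mul_eq_mul_div, le_div_iff₀ (by positivity)]
  linarith

end QuadraticForm

/-! ### The multiplicity of the eigenvalue `μ`. -/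

section Nullity

variable {V : Type*} [Fintype V] {A : Matrix V V ℝ}

open Matrix

/-- The subspace of vectors vanishing on `D`. -/
def vanishingOn (D : Finset V) : Submodule ℝ (V → ℝ) where
  carrier := {c | ∀ v ∈ D, c v = 0}
  add_mem' ha hb v hv := by simp [ha v hv, hb v hv]
  zero_mem' v _ := rfl
  smul_mem' r c hc v hv := by simp [hc v hv]

lemma finrank_le_card_add_finrank_inf (N : Submodule ℝ (V → ℝ)) (D : Finset V) :
    Module.finrank ℝ N ≤ D.card + Module.finrank ℝ ↥(N ⊓ vanishingOn D) := by
  let T : N →ₗ[ℝ] (D → ℝ) := (LinearMap.funLeft ℝ ℝ (fun v : D => (v : V))).comp N.subtype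
  have h1 := T.finrank_range_add_finrank_ker
  have h2 : Module.finrank ℝ T.range ≤ D.card := by
    have := Submodule.finrank_le T.range
    simpa using this
  have h3 : Module.finrank ℝ T.ker ≤ Module.finrank ℝ ↥(N ⊓ vanishingOn D) := by
    refine LinearMap.finrank_le_finrank_of_injective
      (f := (N.subtype.comp T.ker.subtype).codRestrict (N ⊓ vanishingOn D) ?_) ?_
    · rintro ⟨x, hx⟩
      refine ⟨x.2, fun v hv => ?_⟩
      exact congrFun (LinearMap.mem_ker.1 hx) ⟨v, hv⟩
    · intro x y hxy
      have : ((x : N) : V → ℝ) = ((y : N) : V → ℝ) :=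
        congrArg (N ⊓ vanishingOn D).subtype hxy
      exact Subtype.ext (Subtype.ext this)
  omega

/-- A subspace all of whose vectors are delocalised over `H` has small dimension. -/
lemma finrank_le_of_entry_sq_le {ε : ℝ} (hε0 : 0 ≤ ε) (K : Submodule ℝ (V → ℝ)) (H : Set V)
    (hH : ∀ c ∈ K, ∀ v ∉ H, c v = 0) (hε : ∀ c ∈ K, ∀ v ∈ H, c v ^ 2 ≤ ε * (c ⬝ᵥ c)) :
    (Module.finrank ℝ K : ℝ) ≤ ε * H.ncard := by
  classical
  let e : EuclideanSpace ℝ V ≃ₗ[ℝ] (V → ℝ) := WithLp.linearEquiv 2 ℝ (V → ℝ)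
  let K' : Submodule ℝ (EuclideanSpace ℝ V) := K.comap e.toLinearMap
  have hfin : Module.finrank ℝ K' = Module.finrank ℝ K := by
    have : K' = K.map e.symm.toLinearMap := (Submodule.map_equiv_eq_comap_symm e.symm K).symm
    rw [this]
    exact LinearEquiv.finrank_map_eq e.symm K
  let b := stdOrthonormalBasis ℝ K'
  -- `g` is the matrix of the orthogonal projection onto `K`. Its rows lie in `K` and satisfy `g v
  -- ⬝ᵥ g v = g v v`, so delocalisation forces `g v v ≤ ε`; its trace is the dimension.
  let g : V → V → ℝ := fun v u => ∑ i, (b i : EuclideanSpace ℝ V) v * (b i : EuclideanSpace ℝ V) u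
  have hg_mem : ∀ v, g v ∈ K := by
    intro v
    have : (∑ i, (b i : EuclideanSpace ℝ V) v • (e (b i : EuclideanSpace ℝ V))) ∈ K :=
      Submodule.sum_mem _ fun i _ => Submodule.smul_mem _ _ (b i).2
    convert this using 1
    funext u
    simp [g, e]
  have horth : ∀ i j, ∑ u, (b i : EuclideanSpace ℝ V) u * (b j : EuclideanSpace ℝ V) u
      = if i = j then 1 else 0 := by
    intro i j
    have h := orthonormal_iff_ite.1 b.orthonormal j i
    rw [Submodule.coe_inner, PiLp.inner_apply] at h
    simp only [RCLike.inner_apply, conj_trivial] at h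
    rw [h]
    simp [eq_comm]
  have hgg : ∀ v, g v ⬝ᵥ g v = g v v := by
    intro v
    simp only [g, dotProduct, Finset.sum_mul_sum]
    rw [Finset.sum_comm]
    refine Finset.sum_congr rfl fun i _ => ?_
    rw [Finset.sum_comm]
    calc _ = ∑ j, ((b i : EuclideanSpace ℝ V) v * (b j : EuclideanSpace ℝ V) v) *
          ∑ u, (b i : EuclideanSpace ℝ V) u * (b j : EuclideanSpace ℝ V) u := by
          refine Finset.sum_congr rfl fun j _ => ?_
          rw [Finset.mul_sum]
          exact Finset.sum_congr rfl fun u _ => by ring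
      _ = _ := by simp [horth]
  have hle : ∀ v ∈ H, g v v ≤ ε := by
    intro v hv
    have h := hε _ (hg_mem v) v hv
    rw [hgg] at h
    have h0 : 0 ≤ g v v := Finset.sum_nonneg fun i _ => mul_self_nonneg _
    rcases h0.eq_or_lt with h0 | h0
    · rwa [← h0]
    · nlinarith
  have hout : ∀ v ∉ H, g v v = 0 := fun v hv => hH _ (hg_mem v) v hv
  calc (Module.finrank ℝ K : ℝ) = ∑ i : Fin (Module.finrank ℝ K'), (1 : ℝ) := by simp [hfin]
    _ = ∑ i, ∑ u, (b i : EuclideanSpace ℝ V) u * (b i : EuclideanSpace ℝ V) u :=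
      Finset.sum_congr rfl fun i _ => by simp [horth]
    _ = ∑ u, g u u := Finset.sum_comm
    _ ≤ ∑ u, (if u ∈ H then ε else 0) := by
      refine Finset.sum_le_sum fun u _ => ?_
      split_ifs with hu
      · exact hle u hu
      · exact (hout u hu).le
    _ = ε * H.ncard := by
      rw [← Finset.sum_filter, Finset.sum_const, nsmul_eq_mul, mul_comm,
        Set.ncard_eq_toFinset_card' H]
      congr 3
      ext
      simp

lemma indicator_eigenvector {μ : ℝ} {c : V → ℝ} (hc : A *ᵥ c = μ • c) {H : Set V}
    (hH : ∀ i j, A i j ≠ 0 → (i ∈ H ↔ j ∈ H)) : A *ᵥ H.indicator c = μ • H.indicator c := by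
  funext i
  have hi : ∑ j, A i j * c j = μ * c i := congrFun hc i
  change ∑ j, A i j * H.indicator c j = μ * H.indicator c i
  by_cases h : i ∈ H
  · rw [Set.indicator_of_mem h, ← hi]
    refine Finset.sum_congr rfl fun j _ => ?_
    by_cases hij : A i j = 0
    · simp [hij]
    · rw [Set.indicator_of_mem ((hH i j hij).1 h)]
  · rw [Set.indicator_of_notMem h, mul_zero]
    refine Finset.sum_eq_zero fun j _ => ?_
    by_cases hij : A i j = 0
    · simp [hij]
    · rw [Set.indicator_of_notMem (fun hj => h ((hH i j hij).2 hj)), mul_zero]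

lemma indicator_split (H : Set V) (hH : ∀ i j, A i j ≠ 0 → (i ∈ H ↔ j ∈ H)) (f : V → ℝ) :
    f ⬝ᵥ f = H.indicator f ⬝ᵥ H.indicator f + Hᶜ.indicator f ⬝ᵥ Hᶜ.indicator f ∧
    f ⬝ᵥ (A *ᵥ f) = H.indicator f ⬝ᵥ (A *ᵥ H.indicator f) +
      Hᶜ.indicator f ⬝ᵥ (A *ᵥ Hᶜ.indicator f) := by
  constructor
  · simp only [dotProduct, ← Finset.sum_add_distrib]
    refine Finset.sum_congr rfl fun i _ => ?_
    by_cases h : i ∈ H <;> simp [h]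
  · simp only [dotProduct_mulVec_eq_sum, ← Finset.sum_add_distrib]
    refine Finset.sum_congr rfl fun i _ => Finset.sum_congr rfl fun j _ => ?_
    by_cases hij : A i j = 0
    · simp [hij]
    · have := hH i j hij
      by_cases h : i ∈ H
      · simp [h, this.1 h]
      · have hj : j ∉ H := fun hj => h (this.2 hj)
        simp [h, hj]

lemma mem_reachSet_iff_of_adj (hsymm : A.IsSymm) (v i j : V) (hij : A i j ≠ 0) :
    i ∈ reachSet A v ↔ j ∈ reachSet A v :=
  ⟨fun h => mem_reachSet_of_adj h hij, fun h => mem_reachSet_of_adj h (by rwa [hsymm.apply])⟩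

/-- If `μ - A` is not positive semidefinite, this is already seen on one component. -/
lemma exists_component_neg_direction {μ : ℝ} (hsymm : A.IsSymm) :
    ∀ (n : ℕ) (f : V → ℝ), f.support.ncard ≤ n → 0 ≤ f → μ * (f ⬝ᵥ f) < f ⬝ᵥ (A *ᵥ f) →
      ∃ (v : V) (f' : V → ℝ), 0 ≤ f' ∧ (∀ i ∉ reachSet A v, f' i = 0) ∧
        μ * (f' ⬝ᵥ f') < f' ⬝ᵥ (A *ᵥ f') := by
  intro n
  induction n with
  | zero =>
    intro f hf _ hQ
    have : f = 0 := by
      have h0 : f.support = ∅ := (Set.ncard_eq_zero (Set.toFinite _)).1 (by omega)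
      simpa using h0
    simp [this] at hQ
  | succ n ih =>
    intro f hf hf0 hQ
    obtain ⟨v, hv⟩ : ∃ v, f v ≠ 0 := by
      by_contra! h
      have : f = 0 := funext h
      simp [this] at hQ
    obtain ⟨h1, h2⟩ := indicator_split (reachSet A v) (mem_reachSet_iff_of_adj hsymm v) f
    by_cases hH : μ * ((reachSet A v).indicator f ⬝ᵥ (reachSet A v).indicator f) <
        (reachSet A v).indicator f ⬝ᵥ (A *ᵥ (reachSet A v).indicator f)
    · exact ⟨v, _, Set.indicator_nonneg fun i _ => hf0 i,
        fun i hi => Set.indicator_of_notMem hi _, hH⟩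
    · refine ih ((reachSet A v)ᶜ.indicator f) ?_ (Set.indicator_nonneg fun i _ => hf0 i) ?_
      · have : ((reachSet A v)ᶜ.indicator f).support.ncard < f.support.ncard := by
          refine Set.ncard_lt_ncard (ssubset_of_subset_of_ne ?_ ?_) (Set.toFinite _)
          · rw [Set.support_indicator]; exact Set.inter_subset_right
          · intro h
            have h3 : v ∈ f.support := hv
            rw [← h, Set.support_indicator] at h3
            exact h3.1 (self_mem_reachSet v)
        omega
      · push Not at hH
        rw [h1, h2, mul_add] at hQ
        linarith

/-- Eigenspace of `A`, as a subspace of the functions on the vertices. -/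
def eigenSubspace (A : Matrix V V ℝ) (μ : ℝ) : Submodule ℝ (V → ℝ) where
  carrier := {c | A *ᵥ c = μ • c}
  add_mem' {a b} (ha : _ = _) (hb : _ = _) := by
    change A *ᵥ (a + b) = μ • (a + b)
    rw [mulVec_add, ha, hb, smul_add]
  zero_mem' := by simp
  smul_mem' r c (hc : _ = _) := by
    change A *ᵥ (r • c) = μ • (r • c)
    rw [mulVec_smul, hc, smul_comm]

/-- `|c|` attains equality in the form bound, so it is a critical point: a small perturbation along
a nonzero residual `z` would violate the bound. -/
lemma mulVec_abs_eq_of_psd {μ : ℝ} (hsymm : A.IsSymm) (hA : ∀ i j, 0 ≤ A i j)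
    (hpsd : ∀ c : V → ℝ, c ⬝ᵥ (A *ᵥ c) ≤ μ * (c ⬝ᵥ c)) {c : V → ℝ} (hc : A *ᵥ c = μ • c) :
    A *ᵥ |c| = μ • |c| := by
  set g := |c| with hg
  have h0 : g ⬝ᵥ (A *ᵥ g) = μ * (g ⬝ᵥ g) := le_antisymm (hpsd _) (le_abs_of_eigenvector hA hc)
  set z := A *ᵥ g - μ • g with hz
  by_contra hne
  have hz0 : 0 < z ⬝ᵥ z := by
    have h1 : 0 ≤ z ⬝ᵥ z := Finset.sum_nonneg fun i _ => mul_self_nonneg _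
    refine lt_of_le_of_ne h1 fun h => hne ?_
    have := dotProduct_self_eq_zero.1 h.symm
    rwa [hz, sub_eq_zero] at this
  have key : ∀ t : ℝ, 2 * t * (z ⬝ᵥ z) ≤ t ^ 2 * (μ * (z ⬝ᵥ z) - z ⬝ᵥ (A *ᵥ z)) := by
    intro t
    have h := hpsd (g + t • z)
    have e1 : g ⬝ᵥ (A *ᵥ z) = z ⬝ᵥ z + μ * (z ⬝ᵥ g) := by
      rw [dotProduct_mulVec_symm hsymm]
      have : A *ᵥ g = z + μ • g := by rw [hz]; abel
      rw [this, dotProduct_add, dotProduct_smul, smul_eq_mul]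
    have e2 : z ⬝ᵥ (A *ᵥ g) = z ⬝ᵥ z + μ * (z ⬝ᵥ g) := by
      rw [← e1, dotProduct_mulVec_symm hsymm]
    have e3 : g ⬝ᵥ z = z ⬝ᵥ g := dotProduct_comm _ _
    simp only [mulVec_add, mulVec_smul, add_dotProduct, dotProduct_add, smul_dotProduct,
      dotProduct_smul, smul_eq_mul, h0, e1, e2, e3] at h
    nlinarith
  have hM := key 1
  set M := μ * (z ⬝ᵥ z) - z ⬝ᵥ (A *ᵥ z)
  have hMpos : 0 < M := by linarith
  have := key (z ⬝ᵥ z / M)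
  have e : (z ⬝ᵥ z / M) ^ 2 * M = (z ⬝ᵥ z / M) * (z ⬝ᵥ z) := by field_simp
  rw [e] at this
  have hpos : 0 < z ⬝ᵥ z / M * (z ⬝ᵥ z) := by positivity
  nlinarith

/-- If `c` vanishes at a vertex, the equation for the nonnegative eigenvector `|c|` there forces `c`
to vanish at all its neighbours. So vanishing on a dominating set suffices, isolated vertices being
excluded by `μ ≠ 0`. -/
lemma finrank_eigenSubspace_le_of_psd {μ : ℝ} (hμ : 0 < μ) (hsymm : A.IsSymm)
    (hdiag : ∀ i, A i i = 0) (hA : ∀ i j, 0 ≤ A i j)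
    (hpsd : ∀ c : V → ℝ, c ⬝ᵥ (A *ᵥ c) ≤ μ * (c ⬝ᵥ c)) :
    2 * Module.finrank ℝ (eigenSubspace A μ) ≤ Fintype.card V := by
  obtain ⟨D, hD, hdom⟩ := exists_dominating_half hsymm hdiag
  have hbot : eigenSubspace A μ ⊓ vanishingOn D = ⊥ := by
    rw [Submodule.eq_bot_iff]
    rintro c ⟨hc, hcD⟩
    have hc' := mulVec_abs_eq_of_psd hsymm hA hpsd hc
    funext u
    by_contra hu
    have huD : u ∉ D := fun h => hu (hcD u h)
    by_cases hiso : ∃ v, A u v ≠ 0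
    · obtain ⟨v, hv, hvu⟩ := hdom u huD hiso
      have h1 : ∑ j, A v j * |c j| = μ * |c v| := congrFun hc' v
      rw [hcD v hv, abs_zero, mul_zero,
        Finset.sum_eq_zero_iff_of_nonneg fun j _ => mul_nonneg (hA v j) (abs_nonneg _)] at h1
      have := h1 u (Finset.mem_univ u)
      simp only [mul_eq_zero, abs_eq_zero] at this
      exact this.elim hvu hu
    · push Not at hiso
      have h1 : ∑ j, A u j * c j = μ * c u := congrFun hc u
      simp only [hiso, zero_mul, Finset.sum_const_zero] at h1
      exact (mul_eq_zero.1 h1.symm).elim hμ.ne' hu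
  have := finrank_le_card_add_finrank_inf (eigenSubspace A μ) D
  rw [hbot, finrank_bot] at this
  omega

/-- Nullity bound for weighted graphs of bounded degree with at most one eigenvalue above `μ`,
in the quadratic-form sense. -/
theorem finrank_eigenSubspace_le {μ w : ℝ} (hw : 0 < w) (hwμ : w ≤ μ) (Δ : ℕ) :
    ∃ C : ℕ, ∀ (V : Type) [Fintype V] (A : Matrix V V ℝ), A.IsSymm → (∀ i, A i i = 0) →
      (∀ i j, 0 ≤ A i j) → (∀ i j, A i j ≠ 0 → w ≤ A i j) →
      (∀ i, {j | A i j ≠ 0}.ncard ≤ Δ) →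
      (∀ c : V → ℝ, ∑ i, c i = 0 → c ⬝ᵥ (A *ᵥ c) ≤ μ * (c ⬝ᵥ c)) →
      2 * Module.finrank ℝ (eigenSubspace A μ) ≤ Fintype.card V + C := by
  classical
  have hμ : 0 < μ := hw.trans_le hwμ
  have hr0 : 0 ≤ 1 - w ^ 4 / μ ^ 4 := by
    rw [sub_nonneg, div_le_one (by positivity)]
    gcongr
  have hr1 : 1 - w ^ 4 / μ ^ 4 < 1 := by
    have : 0 < w ^ 4 / μ ^ 4 := by positivity
    linarith
  -- 1/6 is what the net of density 1/3 leaves of the target 1/2.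
  obtain ⟨k, hk⟩ := exists_pow_lt_of_lt_one (show (0 : ℝ) < 1 / 6 by norm_num) hr1
  -- The power bounds the ball of radius `2 * k + 1`; the final 2 absorbs the additive 3 in the size
  -- of the net.
  refine ⟨2 * (Δ + 1) ^ (2 * k + 1) + 2, ?_⟩
  intro V _ A hsymm hdiag hA hAw hdeg hP
  by_cases hpsd : ∀ c : V → ℝ, c ⬝ᵥ (A *ᵥ c) ≤ μ * (c ⬝ᵥ c)
  · have := finrank_eigenSubspace_le_of_psd hμ hsymm hdiag hA hpsd
    omega
  -- A violation inside a ball kills every eigenvector vanishing on the ball of radius one larger.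
  by_cases hball : ∃ v, ∃ z : V → ℝ, (∀ i ∉ supportBall A v (2 * k), z i = 0) ∧
      μ * (z ⬝ᵥ z) < z ⬝ᵥ (A *ᵥ z)
  · obtain ⟨v, z, hz, hzQ⟩ := hball
    have hzQ' : μ * (|z| ⬝ᵥ |z|) < |z| ⬝ᵥ (A *ᵥ |z|) := by
      rw [abs_dotProduct_abs]
      exact hzQ.trans_le (dotProduct_mulVec_le_abs hA z)
    have hbot : eigenSubspace A μ ⊓ vanishingOn (supportBall A v (2 * k + 1)) = ⊥ := by
      rw [Submodule.eq_bot_iff]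
      rintro c ⟨hc, hcD⟩
      have hmem : ∀ i, |z| i ≠ 0 → i ∈ supportBall A v (2 * k) := by
        intro i hi
        by_contra h
        exact hi (by simp [hz i h])
      refine abs_separated_eigenvector_eq_zero hsymm hA hP hzQ' hc
        (fun i hi => hcD i (supportBall_mono v (by omega) (hmem i hi))) fun i j hi hij => hcD j ?_
      rw [supportBall_succ]
      exact mem_closedNbhd.2 (Or.inr ⟨i, hmem i hi, hij⟩)
    have h1 := finrank_le_card_add_finrank_inf (eigenSubspace A μ) (supportBall A v (2 * k + 1))
    rw [hbot, finrank_bot] at h1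
    have h2 := card_supportBall_le hdeg v (2 * k + 1)
    omega
  -- The bound fails globally but holds on every ball. A violation on one component makes
  -- eigenvectors vanish off it, and the local bounds give delocalisation.
  · push Not at hpsd hball
    obtain ⟨c₀, hc₀⟩ := hpsd
    obtain ⟨v₀, f, hf0, hfH, hfQ⟩ := exists_component_neg_direction (μ := μ) hsymm _ |c₀| le_rfl
      (abs_nonneg c₀) (by
        rw [abs_dotProduct_abs]
        exact hc₀.trans_le (dotProduct_mulVec_le_abs hA c₀))
    obtain ⟨D, hD, hDnet⟩ := exists_two_step_net (A := A) v₀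
    have hsupp : ∀ c ∈ eigenSubspace A μ, ∀ v ∉ reachSet A v₀, c v = 0 := by
      intro c hc v hv
      have hcomp : ∀ i j, A i j ≠ 0 → (i ∈ (reachSet A v₀)ᶜ ↔ j ∈ (reachSet A v₀)ᶜ) :=
        fun i j hij => not_congr (mem_reachSet_iff_of_adj hsymm v₀ i j hij)
      have hfmem : ∀ i, f i ≠ 0 → i ∈ reachSet A v₀ := fun i hi => by
        by_contra h
        exact hi (hfH i h)
      have h0 := abs_separated_eigenvector_eq_zero hsymm hA hP hfQ
        (indicator_eigenvector hc hcomp) (fun i hi => Set.indicator_of_notMem (by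
          simpa using hfmem i hi) _)
        (fun i j hi hij => Set.indicator_of_notMem (by
          simpa using mem_reachSet_of_adj (hfmem i hi) hij) _)
      have := congrFun h0 v
      rwa [Set.indicator_of_mem (by simpa using hv)] at this
    have hK : (Module.finrank ℝ ↥(eigenSubspace A μ ⊓ vanishingOn D) : ℝ) ≤
        1 / 6 * (reachSet A v₀).ncard := by
      refine finrank_le_of_entry_sq_le (by norm_num) _ _ (fun c hc v hv => hsupp c hc.1 v hv) ?_
      rintro c ⟨hc, hcD⟩ v hv
      have hcc : 0 ≤ c ⬝ᵥ c := Finset.sum_nonneg fun i _ => mul_self_nonneg _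
      by_cases hvD : v ∈ D
      · rw [hcD v hvD]
        nlinarith
      refine (eigenvector_entry_sq_le (U := reachSet A v₀ \ D) hμ hw hsymm hwμ hA ?_ k ⟨hv, hvD⟩
        (hball v) hc ?_).trans (mul_le_mul_of_nonneg_right hk.le hcc)
      · rintro u ⟨huH, huD⟩
        -- A neighbour `t` in `D` supplies the exit walk `u, t, u`.
        rcases hDnet u huH huD with ⟨t, ht, htu⟩ | ⟨t, s, hs, htu, hst⟩
        · have hut : A u t ≠ 0 := by rwa [hsymm.apply]
          exact ⟨t, u, hAw _ _ hut, hAw _ _ htu, Or.inr fun h => h.2 ht⟩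
        · exact ⟨t, s, hAw _ _ hst, hAw _ _ htu, Or.inl fun h => h.2 hs⟩
      · intro i hi
        by_cases hiH : i ∈ reachSet A v₀
        · exact hcD i (by_contra fun h => hi ⟨hiH, h⟩)
        · exact hsupp c hc i hiH
    have h1 := finrank_le_card_add_finrank_inf (eigenSubspace A μ) D
    have h2 : 6 * Module.finrank ℝ ↥(eigenSubspace A μ ⊓ vanishingOn D) ≤
        (reachSet A v₀).ncard := by
      have : (6 : ℝ) * Module.finrank ℝ ↥(eigenSubspace A μ ⊓ vanishingOn D) ≤
        (reachSet A v₀).ncard := by linarith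
      exact_mod_cast this
    have h3 : (reachSet A v₀).ncard ≤ Fintype.card V := by
      rw [← Nat.card_eq_fintype_card]
      exact Set.ncard_le_card _
    omega

end Nullity

/-! ### Sparse families through their Gram matrix. -/

section Gram

variable {V : Type} [Fintype V] {E : Type*} [NormedAddCommGroup E] [InnerProductSpace ℝ E]

open Matrix

/-- The deficiencies `α - ⟪x i, x j⟫` of a family of vectors, off the diagonal. -/
noncomputable def deficiencyMatrix (α : ℝ) (x : V → E) : Matrix V V ℝ := by
  classical exact fun i j => if i = j then 0 else α - inner ℝ (x i) (x j)

variable {α : ℝ} {x : V → E}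

lemma inner_sum_smul (hx : ∀ i, ‖x i‖ = 1) (c : V → ℝ) (i : V) :
    inner ℝ (x i) (∑ j, c j • x j) =
      α * ∑ j, c j + (1 - α) * c i - (deficiencyMatrix α x *ᵥ c) i := by
  classical
  have h : (deficiencyMatrix α x *ᵥ c) i =
      ∑ j, (α * c j - c j * inner ℝ (x i) (x j) + if i = j then (1 - α) * c j else 0) := by
    refine Finset.sum_congr rfl fun j _ => ?_
    by_cases hij : i = j
    · subst hij
      simp [deficiencyMatrix, hx]
      ring
    · simp [deficiencyMatrix, hij]
      ring
  rw [h, inner_sum, Finset.sum_add_distrib, Finset.sum_sub_distrib, Finset.mul_sum]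
  simp [inner_smul_right]

lemma norm_sum_smul_sq (hx : ∀ i, ‖x i‖ = 1) (c : V → ℝ) :
    ‖∑ j, c j • x j‖ ^ 2 =
      α * (∑ j, c j) ^ 2 + (1 - α) * (c ⬝ᵥ c) - c ⬝ᵥ (deficiencyMatrix α x *ᵥ c) := by
  rw [← real_inner_self_eq_norm_sq]
  nth_rw 1 [sum_inner]
  simp only [inner_smul_left, conj_trivial, inner_sum_smul (α := α) hx]
  simp only [dotProduct, mul_sub, mul_add, Finset.sum_sub_distrib, Finset.sum_add_distrib,
    Finset.mul_sum]
  congr 2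
  · rw [pow_two, Finset.sum_mul_sum, Finset.mul_sum]
    refine Finset.sum_congr rfl fun i _ => ?_
    rw [Finset.mul_sum]
    exact Finset.sum_congr rfl fun j _ => by ring
  · exact Finset.sum_congr rfl fun i _ => by ring

/-- Linear relations with coefficient sum zero are eigenvectors. The sum condition is one further
equation, hence the extra 1. -/
lemma card_le_finrank_eigenSubspace_add [FiniteDimensional ℝ E] (hx : ∀ i, ‖x i‖ = 1) :
    Fintype.card V ≤ Module.finrank ℝ (eigenSubspace (deficiencyMatrix α x) (1 - α)) +
      Module.finrank ℝ E + 1 := by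
  let T : (V → ℝ) →ₗ[ℝ] E × ℝ :=
    (Fintype.linearCombination ℝ x).prod (Fintype.linearCombination ℝ (fun _ : V => (1 : ℝ)))
  have h1 := T.finrank_range_add_finrank_ker
  have h2 := Submodule.finrank_le T.range
  have h3 : T.ker ≤ eigenSubspace (deficiencyMatrix α x) (1 - α) := by
    intro c hc
    obtain ⟨hc1, hc2⟩ := Prod.mk.inj (LinearMap.mem_ker.1 hc)
    have e1 : ∑ j, c j • x j = 0 := hc1
    have e2 : ∑ j, c j = 0 := by
      have : ∑ j, c j • (1 : ℝ) = 0 := hc2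
      simpa using this
    funext i
    have h := inner_sum_smul (α := α) hx c i
    rw [e1, e2, inner_zero_right] at h
    simp only [Pi.smul_apply, smul_eq_mul]
    linarith
  have h4 := Submodule.finrank_mono h3
  simp only [Module.finrank_prod, Module.finrank_self, Module.finrank_fintype_fun_eq_card] at h1 h2
  omega

/-- Unit vectors with pairwise inner products equal to `α` or at most `-β`, each vector having at
most `Δ` inner products of the second kind. -/
structure IsSparseFamily (α β : ℝ) (Δ : ℕ) (x : V → E) : Prop where
  norm_eq : ∀ i, ‖x i‖ = 1
  inner_mem : ∀ i j, i ≠ j → inner ℝ (x i) (x j) = α ∨ inner ℝ (x i) (x j) ≤ -β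
  degree_le : ∀ i, {j | j ≠ i ∧ inner ℝ (x i) (x j) ≤ -β}.ncard ≤ Δ

theorem IsSparseFamily.card_le_two_mul {α β : ℝ} (hα : 0 < α) (hβ : 0 < β)
    (h1 : α + β ≤ 1 - α) (Δ : ℕ) :
    ∃ C : ℕ, ∀ (E : Type) [NormedAddCommGroup E] [InnerProductSpace ℝ E] [FiniteDimensional ℝ E]
      (V : Type) [Fintype V] (x : V → E), IsSparseFamily α β Δ x →
      Fintype.card V ≤ 2 * Module.finrank ℝ E + C := by
  classical
  obtain ⟨C, hC⟩ := finrank_eigenSubspace_le (add_pos hα hβ) h1 Δ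
  refine ⟨C + 2, fun E _ _ _ V _ x hx => ?_⟩
  have hdef : ∀ i j, i ≠ j → deficiencyMatrix α x i j = α - inner ℝ (x i) (x j) :=
    fun i j hij => by simp [deficiencyMatrix, hij]
  have hdiag : ∀ i, deficiencyMatrix α x i i = 0 := fun i => by simp [deficiencyMatrix]
  have hval : ∀ i j, deficiencyMatrix α x i j = 0 ∨
      α + β ≤ deficiencyMatrix α x i j ∧ j ≠ i ∧ inner ℝ (x i) (x j) ≤ -β := by
    intro i j
    by_cases hij : i = j
    · exact Or.inl (hij ▸ hdiag i)
    · rw [hdef i j hij]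
      rcases hx.inner_mem i j hij with h | h
      · left; linarith
      · right; exact ⟨by linarith, Ne.symm hij, h⟩
  have hN := hC V (deficiencyMatrix α x) ?_ hdiag ?_ ?_ ?_ ?_
  · have := card_le_finrank_eigenSubspace_add (α := α) hx.norm_eq
    omega
  · ext i j
    by_cases hij : i = j
    · simp [hij]
    · rw [transpose_apply, hdef i j hij, hdef j i (Ne.symm hij), real_inner_comm]
  · intro i j
    rcases hval i j with h | h
    · exact h.ge
    · linarith
  · exact fun i j hij => ((hval i j).resolve_left hij).1
  · exact fun i => (Set.ncard_le_ncard (fun j hij => ((hval i j).resolve_left hij).2)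
      (Set.toFinite _)).trans (hx.degree_le i)
  · intro c hc
    have h := norm_sum_smul_sq (α := α) hx.norm_eq c
    rw [hc] at h
    have := sq_nonneg ‖∑ j, c j • x j‖
    linarith

lemma linearIndependent_of_inner_eq {ι : Type*} {x : ι → E} (hα0 : 0 ≤ α) (hα : α < 1)
    (hx : ∀ i, ‖x i‖ = 1) (hin : ∀ i j, i ≠ j → inner ℝ (x i) (x j) = α) :
    LinearIndependent ℝ x := by
  classical
  rw [linearIndependent_iff']
  intro s c hc i hi
  have h : ‖∑ j ∈ s, c j • x j‖ ^ 2 = α * (∑ j ∈ s, c j) ^ 2 + (1 - α) * ∑ j ∈ s, c j ^ 2 := by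
    rw [← real_inner_self_eq_norm_sq]
    simp only [sum_inner, inner_sum, inner_smul_left, inner_smul_right, conj_trivial]
    have hterm : ∀ k l, c l * (c k * inner ℝ (x k) (x l)) =
        α * (c k * c l) + if k = l then (1 - α) * c k ^ 2 else 0 := by
      intro k l
      by_cases hkl : k = l
      · subst hkl; simp [hx]; ring
      · simp [hkl, hin k l hkl]; ring
    rw [pow_two (∑ j ∈ s, c j), Finset.sum_mul_sum]
    simp only [Finset.mul_sum]
    rw [← Finset.sum_add_distrib]
    refine Finset.sum_congr rfl fun k hk => ?_
    have : ∑ l ∈ s, (if k = l then (1 - α) * c k ^ 2 else 0) = (1 - α) * c k ^ 2 := by simp [hk]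
    rw [← this, ← Finset.sum_add_distrib]
    exact Finset.sum_congr rfl fun l _ => by rw [← hterm, real_inner_comm]; ring
  rw [hc, norm_zero] at h
  have h1 : 0 ≤ α * (∑ j ∈ s, c j) ^ 2 := by positivity
  have h2 : c i ^ 2 ≤ ∑ j ∈ s, c j ^ 2 :=
    Finset.single_le_sum (f := fun j => c j ^ 2) (fun j _ => sq_nonneg _) hi
  have h3 : (1 - α) * c i ^ 2 ≤ 0 := by nlinarith
  have h4 : c i ^ 2 ≤ 0 := by nlinarith
  exact pow_eq_zero_iff (two_ne_zero) |>.1 (le_antisymm h4 (sq_nonneg _))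

/-- For two negative pairs `i, j` and `k, l` with all cross products `α`, the squared norm of `x i +
x j - x k - x l` is at most `4 - 4 * β - 8 * α < 0`. So removing one negative pair and its negative
neighbours, at most `2 * Δ + 2` vectors, leaves a simplex. -/
theorem IsSparseFamily.card_le_add {β : ℝ} (hα : 0 < α) (hα1 : α < 1)
    (h1 : 1 - α < α + β) {Δ : ℕ} [FiniteDimensional ℝ E] (hx : IsSparseFamily α β Δ x) :
    Fintype.card V ≤ Module.finrank ℝ E + (2 * Δ + 2) := by
  classical
  let nb : V → Finset V := fun i => Finset.univ.filter (fun j => j ≠ i ∧ inner ℝ (x i) (x j) ≤ -β)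
  have hnb : ∀ i, (nb i).card ≤ Δ := fun i => by
    have := hx.degree_le i
    rwa [Set.ncard_eq_toFinset_card', Set.toFinset_ofPred] at this
  have hsub : ∀ D : Finset V, (∀ i ∉ D, ∀ j ∉ D, i ≠ j → inner ℝ (x i) (x j) = α) →
      Fintype.card V ≤ Module.finrank ℝ E + D.card := by
    intro D hD
    have hli : LinearIndependent ℝ (fun i : (Dᶜ : Finset V) => x i) :=
      linearIndependent_of_inner_eq hα.le hα1 (fun i => hx.norm_eq i) fun i j hij =>
        hD i (Finset.mem_compl.1 i.2) j (Finset.mem_compl.1 j.2) fun h => hij (Subtype.ext h)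
    have := hli.fintype_card_le_finrank
    rw [Fintype.card_coe, Finset.card_compl] at this
    omega
  by_cases hedge : ∃ i j, i ≠ j ∧ inner ℝ (x i) (x j) ≤ -β
  · obtain ⟨i, j, hij, hle⟩ := hedge
    refine (hsub (insert i (insert j (nb i ∪ nb j))) ?_).trans ?_
    · intro k hk l hl hkl
      by_contra hne
      have hkl' := (hx.inner_mem k l hkl).resolve_left hne
      have hα' : ∀ s t, t ≠ s → t ∉ nb s → inner ℝ (x s) (x t) = α := fun s t hts ht =>
        (hx.inner_mem s t hts.symm).resolve_right fun h => ht (by simp [nb, hts, h])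
      simp only [Finset.mem_insert, Finset.mem_union, not_or] at hk hl
      have e1 := hα' i k hk.1 hk.2.2.1
      have e2 := hα' j k hk.2.1 hk.2.2.2
      have e3 := hα' i l hl.1 hl.2.2.1
      have e4 := hα' j l hl.2.1 hl.2.2.2
      have h := real_inner_self_nonneg (x := x i + x j - x k - x l)
      simp only [inner_sub_left, inner_sub_right, inner_add_left, inner_add_right,
        real_inner_self_eq_norm_sq, hx.norm_eq, e1, e2, e3, e4, real_inner_comm (x i) (x j),
        real_inner_comm (x i) (x k), real_inner_comm (x i) (x l), real_inner_comm (x j) (x k),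
        real_inner_comm (x j) (x l), real_inner_comm (x k) (x l)] at h
      have c1 := real_inner_comm (x i) (x j)
      have c2 := real_inner_comm (x k) (x l)
      linarith
    · have := Finset.card_insert_le i (insert j (nb i ∪ nb j))
      have := Finset.card_insert_le j (nb i ∪ nb j)
      have := Finset.card_union_le (nb i) (nb j)
      have := hnb i
      have := hnb j
      omega
  · push Not at hedge
    have := hsub ∅ fun i _ j _ hij => (hx.inner_mem i j hij).resolve_right (hedge i j hij).not_ge
    simp at this
    omega

end Gram

/-! ### Ramsey's theorem. -/

/-- Ramsey's theorem for graphs, for finite subsets of an arbitrary type. -/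
theorem exists_ramsey (a b : ℕ) : ∃ N : ℕ, ∀ (X : Type) (r : X → X → Prop), Std.Symm r →
    ∀ S : Finset X, N ≤ S.card →
      (∃ T ⊆ S, T.card = a ∧ (T : Set X).Pairwise r) ∨
      (∃ T ⊆ S, T.card = b ∧ (T : Set X).Pairwise fun x y => ¬ r x y) := by
  classical
  induction a generalizing b with
  | zero => exact ⟨0, fun X r _ S _ => Or.inl ⟨∅, by simp, by simp, by simp⟩⟩
  | succ a iha =>
    induction b with
    | zero => exact ⟨0, fun X r _ S _ => Or.inr ⟨∅, by simp, by simp, by simp⟩⟩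
    | succ b ihb =>
      obtain ⟨N₁, h₁⟩ := iha (b + 1)
      obtain ⟨N₂, h₂⟩ := ihb
      -- Besides `v` itself there are at least `N₁` related elements or at least `N₂` unrelated
      -- ones.
      refine ⟨N₁ + N₂ + 1, fun X r hr S hS => ?_⟩
      obtain ⟨v, hv⟩ : S.Nonempty := Finset.card_pos.1 (by omega)
      have hcard := Finset.card_filter_add_card_filter_not (s := S.erase v) (p := r v)
      rw [Finset.card_erase_of_mem hv] at hcard
      have hsub : ∀ (p : X → Prop) [DecidablePred p], (S.erase v).filter p ⊆ S := fun p _ =>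
        (Finset.filter_subset _ _).trans (Finset.erase_subset _ _)
      have hext : ∀ (q : X → X → Prop), (∀ x y, q x y → q y x) → ∀ (p : X → Prop)
          [DecidablePred p], (∀ y, p y → q v y) → ∀ T ⊆ (S.erase v).filter p, ∀ m, T.card = m →
          (T : Set X).Pairwise q →
          ∃ T ⊆ S, T.card = m + 1 ∧ (T : Set X).Pairwise q := by
        intro q hq p _ hp T hT m hm hpair
        refine ⟨insert v T, Finset.insert_subset hv (hT.trans (hsub _)), ?_, ?_⟩
        · rw [Finset.card_insert_of_notMem, hm]
          intro h
          have := hT h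
          simp at this
        · rw [Finset.coe_insert]
          refine hpair.insert fun y hy _ => ?_
          have := hp y (Finset.mem_filter.1 (hT hy)).2
          exact ⟨this, hq _ _ this⟩
      rcases Nat.lt_or_ge ((S.erase v).filter (r v)).card N₁ with hlt | hge
      · rcases h₂ X r hr ((S.erase v).filter fun y => ¬ r v y) (by omega) with
          ⟨T, hT, hc⟩ | ⟨T, hT, hc, hp⟩
        · exact Or.inl ⟨T, hT.trans (hsub _), hc⟩
        · exact Or.inr (hext (fun x y => ¬ r x y) (fun x y h h' => h (hr.symm _ _ h')) _
            (fun y h => h) T hT _ hc hp)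
      · rcases h₁ X r hr _ hge with ⟨T, hT, hc, hp⟩ | ⟨T, hT, hc⟩
        · exact Or.inl (hext r (fun x y h => hr.symm _ _ h) _ (fun y h => h) T hT _ hc hp)
        · exact Or.inr ⟨T, hT.trans (hsub _), hc⟩

/-! ### Simplices in a code and the cover by sparse families. -/

section Structure

variable {E : Type} [NormedAddCommGroup E] [InnerProductSpace ℝ E] {α β : ℝ}

/-- Unit vectors with pairwise inner products equal to `α` or at most `-β`. -/
structure IsGapCode (α β : ℝ) (S : Finset E) : Prop where
  norm_eq : ∀ x ∈ S, ‖x‖ = 1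
  inner_mem : ∀ x ∈ S, ∀ y ∈ S, x ≠ y → inner ℝ x y = α ∨ inner ℝ x y ≤ -β

lemma IsGapCode.mono {S T : Finset E} (hS : IsGapCode α β S) (hT : T ⊆ S) : IsGapCode α β T :=
  ⟨fun x hx => hS.norm_eq x (hT hx), fun x hx y hy => hS.inner_mem x (hT hx) y (hT hy)⟩

/-- Unit vectors with all pairwise inner products equal to `α`. -/
structure IsSimplexCode (α : ℝ) (I : Finset E) : Prop where
  norm_eq : ∀ x ∈ I, ‖x‖ = 1
  inner_eq : ∀ x ∈ I, ∀ y ∈ I, x ≠ y → inner ℝ x y = α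

lemma norm_sq_sum_le {ι : Type*} (F : Finset ι) (v : ι → E) {a b : ℝ}
    (ha : ∀ i ∈ F, inner ℝ (v i) (v i) ≤ a)
    (hb : ∀ i ∈ F, ∀ j ∈ F, i ≠ j → inner ℝ (v i) (v j) ≤ b) :
    ‖∑ i ∈ F, v i‖ ^ 2 ≤ F.card * a + F.card * (F.card - 1) * b := by
  classical
  rw [← real_inner_self_eq_norm_sq, sum_inner]
  have : ∀ i ∈ F, inner ℝ (v i) (∑ j ∈ F, v j) ≤ a + (F.card - 1) * b := by
    intro i hi
    rw [inner_sum, ← Finset.add_sum_erase _ _ hi]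
    refine add_le_add (ha i hi) ?_
    have h := Finset.sum_le_card_nsmul (F.erase i) (fun j => inner ℝ (v i) (v j)) b fun j hj =>
      hb i hi j (Finset.mem_of_mem_erase hj) (Finset.ne_of_mem_erase hj).symm
    rw [Finset.card_erase_of_mem hi, nsmul_eq_mul,
      Nat.cast_sub (Finset.card_pos.2 ⟨i, hi⟩)] at h
    simpa using h
  have h := Finset.sum_le_card_nsmul F _ _ this
  rw [nsmul_eq_mul] at h
  linarith

lemma IsSimplexCode.inner_sum_left {I : Finset E} (hI : IsSimplexCode α I) {x : E} (hx : x ∈ I) :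
    inner ℝ x (∑ y ∈ I, y) = (1 - α) + α * I.card := by
  classical
  rw [inner_sum, ← Finset.add_sum_erase _ _ hx, real_inner_self_eq_norm_sq, hI.norm_eq x hx,
    Finset.sum_congr rfl fun y hy => hI.inner_eq x hx y (Finset.mem_of_mem_erase hy)
      (Finset.ne_of_mem_erase hy).symm, Finset.sum_const, Finset.card_erase_of_mem hx,
    nsmul_eq_mul, Nat.cast_sub (Finset.card_pos.2 ⟨x, hx⟩)]
  push_cast
  ring

lemma IsSimplexCode.mono {I J : Finset E} (hI : IsSimplexCode α I) (hJ : J ⊆ I) :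
    IsSimplexCode α J :=
  ⟨fun x hx => hI.norm_eq x (hJ hx), fun x hx y hy => hI.inner_eq x (hJ hx) y (hJ hy)⟩

lemma IsSimplexCode.inner_sum_self {I : Finset E} (hI : IsSimplexCode α I) :
    inner ℝ (∑ y ∈ I, y) (∑ y ∈ I, y) = (1 - α) * I.card + α * I.card ^ 2 := by
  rw [sum_inner, Finset.sum_congr rfl fun x hx => hI.inner_sum_left hx, Finset.sum_const,
    nsmul_eq_mul]
  ring

lemma IsSimplexCode.inner_sum_disjoint {I J₁ J₂ : Finset E} (hI : IsSimplexCode α I)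
    (h₁ : J₁ ⊆ I) (h₂ : J₂ ⊆ I) (hd : Disjoint J₁ J₂) :
    inner ℝ (∑ y ∈ J₁, y) (∑ y ∈ J₂, y) = α * (J₁.card * J₂.card) := by
  have : ∀ x ∈ J₁, inner ℝ x (∑ y ∈ J₂, y) = J₂.card * α := fun x hx => by
    rw [inner_sum, Finset.sum_congr rfl fun y hy => hI.inner_eq x (h₁ hx) y (h₂ hy)
      (fun h => Finset.disjoint_left.1 hd hx (h ▸ hy)), Finset.sum_const, nsmul_eq_mul]
  rw [sum_inner, Finset.sum_congr rfl this, Finset.sum_const, nsmul_eq_mul]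
  ring

/-- A vector of a gap code is on almost the same side of every vector of a large simplex. -/
lemma near_or_far {S I : Finset E} (hS : IsGapCode α β S) (hIS : I ⊆ S) (hI : IsSimplexCode α I)
    (hα : 0 < α) (hα1 : α < 1) (hβ : 0 < β) (hβ1 : β < 1) {x : E} (hx : x ∈ S) :
    α * I.card - 4 / (α + β) ^ 2 ≤ inner ℝ x (∑ y ∈ I, y) ∨
      inner ℝ x (∑ y ∈ I, y) ≤ -β * I.card + 4 / (α + β) ^ 2 := by
  classical
  have hγ : 0 < α + β := by linarith
  have hK : 0 < 4 / (α + β) ^ 2 := by positivity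
  by_cases hxI : x ∈ I
  · left
    rw [hI.inner_sum_left hxI]
    linarith
  set J₁ := I.filter (fun y => inner ℝ x y ≤ -β) with hJ₁
  set J₂ := I.filter (fun y => ¬ inner ℝ x y ≤ -β) with hJ₂
  have hs₁ : J₁ ⊆ I := Finset.filter_subset _ _
  have hs₂ : J₂ ⊆ I := Finset.filter_subset _ _
  have hd : Disjoint J₁ J₂ := Finset.disjoint_filter_filter_not _ _ _
  have hcard : J₁.card + J₂.card = I.card := Finset.card_filter_add_card_filter_not _
  have hsum : inner ℝ x (∑ y ∈ I, y) = inner ℝ x (∑ y ∈ J₁, y) + inner ℝ x (∑ y ∈ J₂, y) := by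
    rw [← inner_add_right, Finset.sum_filter_add_sum_filter_not]
  have hin₂ : inner ℝ x (∑ y ∈ J₂, y) = J₂.card * α := by
    rw [inner_sum, Finset.sum_congr rfl (g := fun _ => α), Finset.sum_const, nsmul_eq_mul]
    intro y hy
    rw [hJ₂, Finset.mem_filter] at hy
    exact (hS.inner_mem x hx y (hIS hy.1) fun h => hxI (h ▸ hy.1)).resolve_right hy.2
  have hin₁ : inner ℝ x (∑ y ∈ J₁, y) ≤ J₁.card * -β := by
    rw [inner_sum, ← nsmul_eq_mul]
    exact Finset.sum_le_card_nsmul _ _ _ fun y hy => (Finset.mem_filter.1 hy).2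
  have hin₁' : J₁.card * (-1 : ℝ) ≤ inner ℝ x (∑ y ∈ J₁, y) := by
    rw [inner_sum, ← nsmul_eq_mul]
    refine Finset.card_nsmul_le_sum _ _ _ fun y hy => ?_
    have := abs_real_inner_le_norm x y
    rw [hS.norm_eq x hx, hI.norm_eq y (hs₁ hy), mul_one] at this
    exact (abs_le.1 this).1
  have hcast : (J₁.card : ℝ) + J₂.card = I.card := by exact_mod_cast hcard
  set a : ℝ := (J₁.card : ℝ) with ha
  set b : ℝ := (J₂.card : ℝ) with hb
  have ha0 : 0 ≤ a := Nat.cast_nonneg _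
  have hb0 : 0 ≤ b := Nat.cast_nonneg _
  -- The coefficients of `u` sum to zero, which cancels the quadratic contribution of `α` to its
  -- norm, while `x` pairs with `u` to at most `-(a * b * (α + β))`. Cauchy-Schwarz makes the
  -- smaller of `a`, `b` bounded.
  have hab : (a * b * (α + β)) ^ 2 ≤ (1 - α) * (a * b) * (a + b) := by
    set u := b • (∑ y ∈ J₁, y) - a • (∑ y ∈ J₂, y) with hu
    have hu2 : inner ℝ u u = (1 - α) * (a * b) * (a + b) := by
      rw [hu]
      simp only [inner_sub_left, inner_sub_right, inner_smul_left, inner_smul_right, conj_trivial,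
        (hI.mono hs₁).inner_sum_self, (hI.mono hs₂).inner_sum_self,
        hI.inner_sum_disjoint hs₁ hs₂ hd, hI.inner_sum_disjoint hs₂ hs₁ hd.symm]
      rw [← ha, ← hb]
      ring
    have hxu : inner ℝ x u ≤ -(a * b * (α + β)) := by
      rw [hu, inner_sub_right, inner_smul_right, inner_smul_right, hin₂]
      nlinarith
    have hcs := real_inner_mul_inner_self_le x u
    rw [hu2, real_inner_self_eq_norm_sq, hS.norm_eq x hx] at hcs
    have h0 : 0 ≤ a * b * (α + β) := by positivity
    nlinarith
  have hab' : a * b * (α + β) ^ 2 ≤ a + b := by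
    rcases (mul_nonneg ha0 hb0).eq_or_lt with h | h
    · rw [← h]; linarith
    · have h2 : a * b * (a * b * (α + β) ^ 2) ≤ a * b * (a + b) := by
        nlinarith [mul_nonneg (mul_nonneg h.le (add_nonneg ha0 hb0)) hα.le]
      exact le_of_mul_le_mul_left h2 h
  -- The factor 2 is the most by which one vector of the minority class can shift the sum.
  have hmin : ∀ s t : ℝ, 0 ≤ s → s ≤ t → s * t * (α + β) ^ 2 ≤ s + t →
      2 * s ≤ 4 / (α + β) ^ 2 := by
    intro s t hs hst h
    rw [le_div_iff₀ (by positivity)]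
    rcases (hs.trans hst).eq_or_lt with h0 | h0
    · have : s = 0 := by linarith
      simp [this]
    · have h3 : t * (s * (α + β) ^ 2) ≤ t * 2 := by nlinarith
      have := le_of_mul_le_mul_left h3 h0
      linarith
  rw [hsum, hin₂, ← hcast]
  rcases le_total a b with hle | hle
  · left
    have := hmin a b ha0 hle hab'
    nlinarith
  · right
    have := hmin b a hb0 hle (by linarith)
    nlinarith

/-- Ramsey applies because `m + 1` unit vectors with pairwise products at most `-β` would have a sum
of squared norm at most `(m + 1) * (1 - m * β) < 0`. -/
lemma exists_simplex_of_card_ge (hβ : 0 < β) (T : ℕ) :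
    ∃ R : ℕ, ∀ (E : Type) [NormedAddCommGroup E] [InnerProductSpace ℝ E] (S : Finset E),
      IsGapCode α β S → R ≤ S.card → ∃ I ⊆ S, I.card = T ∧ IsSimplexCode α I := by
  obtain ⟨m, hm⟩ := exists_nat_gt (1 / β)
  obtain ⟨R, hR⟩ := exists_ramsey (m + 1) T
  refine ⟨R, fun E _ _ S hS hcard => ?_⟩
  rcases hR E (fun x y => inner ℝ x y ≤ -β) ⟨fun x y h => by rwa [real_inner_comm]⟩ S hcard with
    ⟨I, hIS, hIc, hI⟩ | ⟨I, hIS, hIc, hI⟩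
  · exfalso
    have h := norm_sq_sum_le I (fun y => y) (a := 1) (b := -β)
      (fun y hy => by rw [real_inner_self_eq_norm_sq, hS.norm_eq y (hIS hy)]; norm_num)
      fun x hx y hy hxy => hI hx hy hxy
    have h0 := sq_nonneg ‖∑ y ∈ I, y‖
    rw [hIc] at h
    push_cast at h
    rw [div_lt_iff₀ hβ] at hm
    have hm0 : (0 : ℝ) ≤ m := Nat.cast_nonneg m
    nlinarith
  · exact ⟨I, hIS, hIc, fun x hx => hS.norm_eq x (hIS hx), fun x hx y hy hxy =>
      (hS.inner_mem x (hIS hx) y (hIS hy) hxy).resolve_right (hI hx hy hxy)⟩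

/-- All conditions hold in the limit of large `T`. The first caps the number of pairwise far
simplices at `p`; the last forbids a unit vector near one simplex and negative on another when the
two are near each other. -/
lemma exists_simplex_size (hα : 0 < α) (hβ : 0 < β) {p : ℕ} (hp : α < p * β) :
    ∃ T : ℕ, 0 < T ∧ α + 1 / T < p * (β - 4 / (α + β) ^ 2 / T) ∧
      0 < α + β - 4 / (α + β) ^ 2 / T ∧ 0 < β - 4 / (α + β) ^ 2 / T ∧
      2 / T + 2 * (4 / (α + β) ^ 2 / T) < (α + β - 4 / (α + β) ^ 2 / T) ^ 2 := by
  set K := 4 / (α + β) ^ 2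
  have hlim : ∀ C : ℝ, Tendsto (fun T : ℕ => C / (T : ℝ)) atTop (nhds 0) :=
    fun C => tendsto_const_div_atTop_nhds_zero_nat C
  have e1 : ∀ᶠ T : ℕ in atTop, α + 1 / (T : ℝ) < p * (β - K / T) :=
    ((hlim 1).const_add α).eventually_lt (((hlim K).const_sub β).const_mul (p : ℝ))
      (by rwa [add_zero, sub_zero])
  have e2 : ∀ᶠ T : ℕ in atTop, 0 < α + β - K / T :=
    ((hlim K).const_sub (α + β)).eventually_const_lt (by rw [sub_zero]; positivity)
  have e3 : ∀ᶠ T : ℕ in atTop, 0 < β - K / T :=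
    ((hlim K).const_sub β).eventually_const_lt (by rwa [sub_zero])
  have e4 : ∀ᶠ T : ℕ in atTop, 2 / (T : ℝ) + 2 * (K / T) < (α + β - K / T) ^ 2 :=
    ((hlim 2).add ((hlim K).const_mul 2)).eventually_lt (((hlim K).const_sub (α + β)).pow 2)
      (by rw [mul_zero, add_zero, sub_zero]; positivity)
  obtain ⟨T, h0, h1, h2, h3, h4⟩ :=
    ((eventually_gt_atTop 0).and (e1.and (e2.and (e3.and e4)))).exists
  exact ⟨T, h0, h1, h2, h3, h4⟩

/-- A gap code is covered, up to boundedly many vectors, by at most `p` subsets in which every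
vector has boundedly many negative inner products. -/
theorem exists_sparse_cover (hα : 0 < α) (hα1 : α < 1) (hβ : 0 < β) (hβ1 : β < 1) {p : ℕ}
    (hp : α < p * β) :
    ∃ N : ℕ, ∀ (E : Type) [NormedAddCommGroup E] [InnerProductSpace ℝ E] (S : Finset E),
      IsGapCode α β S → ∃ (F : Finset (Finset E)) (W : Finset E → Finset E), F.card ≤ p ∧
        S.card ≤ N + ∑ I ∈ F, (W I).card ∧
        ∀ I ∈ F, IsSparseFamily α β N (fun x : W I => (x : E)) := by
  classical
  obtain ⟨T, hT0, hT1, hT2, hT3, hT4⟩ := exists_simplex_size hα hβ hp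
  obtain ⟨R, hR⟩ := exists_simplex_of_card_ge (α := α) hβ T
  refine ⟨R, fun E _ _ S hS => ?_⟩
  have hT : (0 : ℝ) < T := Nat.cast_pos.2 hT0
  set K := 4 / (α + β) ^ 2 with hK
  have hKT : K = K / T * T := by field_simp
  set ε := K / T
  clear_value ε K
  let P : Finset (Finset E) → Prop := fun F =>
    (∀ I ∈ F, I.card = T ∧ I ⊆ S ∧ IsSimplexCode α I) ∧
    ∀ I ∈ F, ∀ J ∈ F, I ≠ J → inner ℝ (∑ y ∈ I, y) (∑ y ∈ J, y) ≤ (-β + ε) * T ^ 2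
  obtain ⟨F, hF, hmax⟩ : ∃ F, P F ∧ ∀ F', P F' → F'.card ≤ F.card := by
    obtain ⟨F, hF, hm⟩ := Finset.exists_max_image (S.powerset.powerset.filter P) Finset.card
      ⟨∅, by simp [P]⟩
    refine ⟨F, (Finset.mem_filter.1 hF).2, fun F' hF' => hm F' (Finset.mem_filter.2 ⟨?_, hF'⟩)⟩
    exact Finset.mem_powerset.2 fun I hI => Finset.mem_powerset.2 (hF'.1 I hI).2.1
  have hself : ∀ I : Finset E, I.card = T → IsSimplexCode α I →
      inner ℝ (∑ y ∈ I, y) (∑ y ∈ I, y) ≤ T + α * T ^ 2 := by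
    intro I hc hI
    rw [hI.inner_sum_self, hc]
    nlinarith
  have hnf : ∀ x ∈ S, ∀ I ∈ F, ¬ (α - ε) * T ≤ inner ℝ x (∑ y ∈ I, y) →
      inner ℝ x (∑ y ∈ I, y) ≤ (-β + ε) * T := by
    intro x hx I hI h
    obtain ⟨hc, hs, hi⟩ := hF.1 I hI
    have := near_or_far hS hs hi hα hα1 hβ hβ1 hx
    rw [← hK, hc] at this
    rcases this with h' | h'
    · exact absurd (by linarith) h
    · linarith
  let W : Finset E → Finset E := fun I =>
    S.filter (fun x => (α - ε) * T ≤ inner ℝ x (∑ y ∈ I, y))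
  refine ⟨F, W, ?_, ?_, ?_⟩
  -- With more than `p` members, the sum of all the simplex sums would have negative squared norm.
  · by_contra hcon
    push Not at hcon
    have h := norm_sq_sum_le F (fun I => ∑ y ∈ I, y) (fun I hI => hself I (hF.1 I hI).1
      (hF.1 I hI).2.2) hF.2
    have h0 := sq_nonneg ‖∑ I ∈ F, ∑ y ∈ I, y‖
    have hk : (p : ℝ) + 1 ≤ F.card := by exact_mod_cast hcon
    have hk0 : (0 : ℝ) < F.card := by have := Nat.cast_nonneg (α := ℝ) p; linarith
    have h1 : 0 ≤ (F.card * T ^ 2 : ℝ) * ((α + 1 / T) - (F.card - 1) * (β - ε)) := by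
      have : (F.card * T ^ 2 : ℝ) * ((α + 1 / T) - (F.card - 1) * (β - ε)) =
          F.card * (T + α * T ^ 2) + F.card * (F.card - 1) * ((-β + ε) * T ^ 2) := by
        field_simp
        ring
      rw [this]
      exact h0.trans h
    have h2 : 0 ≤ (α + 1 / T) - (F.card - 1) * (β - ε) :=
      nonneg_of_mul_nonneg_right h1 (by positivity)
    nlinarith
  -- Otherwise the uncovered vectors contain a simplex far from every member of `F`, which could be
  -- added to `F`.
  · have hE : (S.filter fun x => ∀ I ∈ F, x ∉ W I).card < R := by
      by_contra hcon
      push Not at hcon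
      obtain ⟨J, hJ, hJc, hJs⟩ := hR E _ (hS.mono (Finset.filter_subset _ _)) hcon
      have hJS : J ⊆ S := hJ.trans (Finset.filter_subset _ _)
      have hfar : ∀ I ∈ F, inner ℝ (∑ y ∈ J, y) (∑ y ∈ I, y) ≤ (-β + ε) * T ^ 2 := by
        intro I hI
        rw [sum_inner]
        refine (Finset.sum_le_card_nsmul J _ ((-β + ε) * T) fun x hx => ?_).trans (le_of_eq ?_)
        · have hx' := Finset.mem_filter.1 (hJ hx)
          exact hnf x hx'.1 I hI fun h => hx'.2 I hI (Finset.mem_filter.2 ⟨hx'.1, h⟩)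
        · rw [hJc, nsmul_eq_mul]; ring
      have hJF : J ∉ F := by
        intro h
        have h1 := hfar J h
        have h2 := real_inner_self_nonneg (x := ∑ y ∈ J, y)
        have h3 : 0 < (β - ε) * (T : ℝ) ^ 2 := by positivity
        nlinarith
      have hP' : P (insert J F) := by
        constructor
        · intro I hI
          rcases Finset.mem_insert.1 hI with h | h
          · rw [h]; exact ⟨hJc, hJS, hJs⟩
          · exact hF.1 I h
        · intro I hI I' hI' hne
          rcases Finset.mem_insert.1 hI with h | h <;> rcases Finset.mem_insert.1 hI' with h' | h'
          · exact absurd (h.trans h'.symm) hne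
          · rw [h]; exact hfar I' h'
          · rw [h', real_inner_comm]; exact hfar I h
          · exact hF.2 I h I' h' hne
      have := hmax _ hP'
      rw [Finset.card_insert_of_notMem hJF] at this
      omega
    have hsub : S ⊆ (S.filter fun x => ∀ I ∈ F, x ∉ W I) ∪ F.biUnion W := by
      intro x hx
      by_cases h : ∀ I ∈ F, x ∉ W I
      · exact Finset.mem_union_left _ (Finset.mem_filter.2 ⟨hx, h⟩)
      · push Not at h
        exact Finset.mem_union_right _ (Finset.mem_biUnion.2 h)
    calc S.card ≤ _ := Finset.card_le_card hsub
      _ ≤ _ := Finset.card_union_le _ _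
      _ ≤ R + ∑ I ∈ F, (W I).card := add_le_add hE.le Finset.card_biUnion_le
  · intro I hI
    obtain ⟨hIc, hIS, hIs⟩ := hF.1 I hI
    have hWS : W I ⊆ S := Finset.filter_subset _ _
    refine ⟨fun x => hS.norm_eq x (hWS x.2), fun x y hxy => hS.inner_mem x (hWS x.2) y (hWS y.2)
      fun h => hxy (Subtype.ext h), fun x => ?_⟩
    let B : Finset E := (W I).filter fun y => y ≠ x ∧ inner ℝ (x : E) y ≤ -β
    have hBcard : {j : W I | j ≠ x ∧ inner ℝ (x : E) (j : E) ≤ -β}.ncard ≤ B.card := by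
      rw [← Set.ncard_coe_finset B]
      refine Set.ncard_le_ncard_of_injOn (fun j : W I => (j : E)) ?_
        Subtype.val_injective.injOn (Set.toFinite _)
      rintro j ⟨hj, hj'⟩
      exact Finset.mem_coe.2 (Finset.mem_filter.2 ⟨j.2, fun h => hj (Subtype.ext h), hj'⟩)
    refine hBcard.trans ?_
    by_contra hcon
    push Not at hcon
    -- `J` consists of negative neighbours of `x` that are near `I`. So the sums over `I` and `J`
    -- are close to each other, yet `x` separates them by `(α + β - ε) * T`: this contradicts
    -- Cauchy-Schwarz.
    obtain ⟨J, hJ, hJc, hJs⟩ := hR E B (hS.mono ((Finset.filter_subset _ _).trans hWS)) hcon.le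
    have hIJ : (α - ε) * T ^ 2 ≤ inner ℝ (∑ y ∈ J, y) (∑ y ∈ I, y) := by
      rw [sum_inner]
      refine (le_of_eq ?_).trans (Finset.card_nsmul_le_sum J _ ((α - ε) * T) fun y hy => ?_)
      · rw [hJc, nsmul_eq_mul]; ring
      · exact (Finset.mem_filter.1 (Finset.mem_filter.1 (hJ hy)).1).2
    have hxJ : inner ℝ (x : E) (∑ y ∈ J, y) ≤ -β * T := by
      rw [inner_sum]
      refine (Finset.sum_le_card_nsmul J _ (-β) fun y hy => ?_).trans (le_of_eq ?_)
      · exact (Finset.mem_filter.1 (hJ hy)).2.2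
      · rw [hJc, nsmul_eq_mul]; ring
    have hxI := (Finset.mem_filter.1 x.2).2
    have hcs := real_inner_mul_inner_self_le (x : E) ((∑ y ∈ I, y) - ∑ y ∈ J, y)
    have hlow : (α + β - ε) * T ≤ inner ℝ (x : E) ((∑ y ∈ I, y) - ∑ y ∈ J, y) := by
      rw [inner_sub_right]; linarith
    have hup : inner ℝ ((∑ y ∈ I, y) - ∑ y ∈ J, y) ((∑ y ∈ I, y) - ∑ y ∈ J, y) ≤
        2 * T + 2 * ε * T ^ 2 := by
      have c := real_inner_comm (∑ y ∈ I, y) (∑ y ∈ J, y)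
      have s1 := hself I hIc hIs
      have s2 := hself J hJc hJs
      simp only [inner_sub_left, inner_sub_right]
      linarith
    rw [real_inner_self_eq_norm_sq, hS.norm_eq x (hWS x.2)] at hcs
    have h1 : ((α + β - ε) * T) ^ 2 ≤ 2 * T + 2 * ε * T ^ 2 := by
      have : 0 ≤ (α + β - ε) * T := by positivity
      nlinarith
    have h2 : (2 / T + 2 * ε) * T ^ 2 < (α + β - ε) ^ 2 * T ^ 2 :=
      mul_lt_mul_of_pos_right hT4 (by positivity)
    have h3 : (2 / T + 2 * ε) * T ^ 2 = 2 * T + 2 * ε * T ^ 2 := by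
      field_simp
    nlinarith

end Structure

/-! ### From sparse families to the bounds on spherical codes. -/

lemma maxCodeSize_le_of_finset {L : Set ℝ} {d n : ℕ}
    (h : ∀ S : Finset (EuclideanSpace ℝ (Fin d)), IsSphericalCode L (S : Set (EuclideanSpace ℝ (Fin d))) → S.card ≤ n) :
    maxCodeSize L d ≤ n := by
  refine iSup₂_le fun C hC => ?_
  by_contra hcon
  push Not at hcon
  -- A code that is too large, possibly infinite, contains a subcode of exactly `n + 1` vectors.
  obtain ⟨t, htC, ht⟩ := Set.exists_subset_encard_eq (Order.add_one_le_of_lt hcon)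
  have hfin : t.Finite := Set.finite_of_encard_eq_coe (k := n + 1) (by rw [ht]; norm_cast)
  have := h hfin.toFinset ⟨fun x hx => hC.1 x (htC (by simpa using hx)), by
    rw [hfin.coe_toFinset]; exact hC.2.mono htC⟩
  rw [hfin.encard_eq_coe_toFinset_card] at ht
  have ht' : hfin.toFinset.card = n + 1 := by exact_mod_cast ht
  omega

/-- A bound for sparse families gives one for spherical codes, multiplied by `p`. -/
lemma exists_maxCodeSize_le {α β : ℝ} (hα : α ∈ Set.Ioo (0 : ℝ) 1) (hβ : β ∈ Set.Ioo (0 : ℝ) 1)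
    {p : ℕ} (hp : α < p * β) {m : ℕ}
    (hsparse : ∀ Δ : ℕ, ∃ C : ℕ, ∀ (d : ℕ) (V : Type) [Fintype V]
      (x : V → EuclideanSpace ℝ (Fin d)), IsSparseFamily α β Δ x → Fintype.card V ≤ m * d + C) :
    ∃ K : ℕ, ∀ d : ℕ,
      maxCodeSize (Set.Icc (-1) (-β) ∪ {α}) d ≤ ((m * p * d + K : ℕ) : ℕ∞) := by
  obtain ⟨N, hN⟩ := exists_sparse_cover hα.1 hα.2 hβ.1 hβ.2 hp
  obtain ⟨C, hC⟩ := hsparse N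
  refine ⟨N + p * C, fun d => maxCodeSize_le_of_finset fun S hS => ?_⟩
  obtain ⟨F, W, hF, hcard, hW⟩ := hN _ S ⟨hS.1, fun x hx y hy hxy => by
    rcases hS.2 hx hy hxy with h | h
    · exact Or.inr h.2
    · exact Or.inl h⟩
  calc S.card ≤ N + ∑ I ∈ F, (W I).card := hcard
    _ ≤ N + F.card * (m * d + C) := by
      refine Nat.add_le_add_left (Finset.sum_le_card_nsmul F _ _ fun I hI => ?_) _
      simpa using hC d (W I) _ (hW I hI)
    _ ≤ N + p * (m * d + C) := by gcongr
    _ = m * p * d + (N + p * C) := by ring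

theorem mainTheorem4 (α β : ℝ) (hα : α ∈ Set.Ioo (0 : ℝ) 1) (hβ : β ∈ Set.Ioo (0 : ℝ) 1)
    (p : ℕ) (hp : p = ⌊α / β⌋₊ + 1)
    (lam : ℝ) (hlam : lam = (1 - α) / (α + β))
    (L : Set ℝ) (hL : L = Set.Icc (-1) (-β) ∪ {α}) :
    (1 ≤ lam → ∃ K : ℕ, ∀ d : ℕ,
      maxCodeSize L d ≤ ((2 * p * d + K : ℕ) : ℕ∞)) ∧
    (lam < 1 → ∃ e : ℕ → ℕ,
      (fun d : ℕ => (e d : ℝ)) =o[atTop] (fun d : ℕ => (d : ℝ)) ∧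
      ∀ d : ℕ, maxCodeSize L d ≤ ((p * d + e d : ℕ) : ℕ∞)) := by
  have hγ : 0 < α + β := add_pos hα.1 hβ.1
  have hpβ : α < p * β := by
    rw [← div_lt_iff₀ hβ.1, hp]
    exact_mod_cast Nat.lt_floor_add_one (α / β)
  subst hL hlam
  constructor
  · intro h
    rw [le_div_iff₀ hγ, one_mul] at h
    refine exists_maxCodeSize_le hα hβ hpβ fun Δ => ?_
    obtain ⟨C, hC⟩ := IsSparseFamily.card_le_two_mul hα.1 hβ.1 h Δ
    exact ⟨C, fun d V _ x hx => by simpa using hC _ V x hx⟩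
  · intro h
    rw [div_lt_one hγ] at h
    obtain ⟨K, hK⟩ := exists_maxCodeSize_le (m := 1) hα hβ hpβ fun Δ =>
      ⟨2 * Δ + 2, fun d V _ x hx => by
        simpa using IsSparseFamily.card_le_add hα.1 hα.2 h hx⟩
    -- The error term is in fact constant, stronger than the `o(d)` required.
    refine ⟨fun _ => K, ?_, fun d => by simpa using hK d⟩
    exact isLittleO_const_left.2 (Or.inr (tendsto_norm_atTop_atTop.comp
      tendsto_natCast_atTop_atTop))
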